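/- For $\Re(w)>0$ and real $\mu$ let $K_\mu(w)=\int_0^\infty e^{-w\cosh u}\cosh(\mu u)\,du$ be the modified Bessel function of the second kind, let $B(\alpha,\beta)=\Gamma(\alpha)\Gamma(\beta)/\Gamma(\alpha+\beta)$, and for $\Re(p)>0$, $\nu\ge 0$ let $$B_{p,\nu}(\alpha,\beta)=\sqrt{\tfrac{2p}{\pi}}\int_0^1 t^{\alpha-\frac32}(1-t)^{\beta-\frac32}K_{\nu+\frac12}\Big(\frac{p}{t(1-t)}\Big)\,dt .$$ With the Pochhammer symbol $(\lambda)_n=\lambda(\lambda+1)\cdots(\lambda+n-1)$, define $$H_{B,p,\nu}=\sum_{m,n,k=0}^\infty\frac{(b_1+b_2)_{2m+n+k}(b_3)_{n+k}}{(c_1)_m(c_2)_n(c_3)_k}\,\frac{B_{p,\nu}(b_1+m+k,b_2+m+n)}{B(b_1,b_2)}\,\frac{x^m}{m!}\frac{y^n}{n!}\frac{z^k}{k!},$$ $$H_B^{(a)}=\sum_{m,n,k=0}^\infty\frac{(b_1+b_2)_{2m+n+k}(b_3)_{n+k}}{(c_1)_m(c_2)_n(c_3)_k}\,\frac{B(b_1+a+m+k,b_2+a+m+n)}{B(b_1,b_2)}\,\frac{x^m}{m!}\frac{y^n}{n!}\frac{z^k}{k!},$$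 both with arguments $(b_1,b_2,b_3;c_1,c_2,c_3;x,y,z)$. Let $p\in\mathbb C$ with $\Re(p)>0$, let $\nu\ge 0$, let $b_1,b_2,b_3,c_1,c_2,c_3\in\mathbb C$ with none of $b_1,b_2,b_1+b_2,c_1,c_2,c_3$ in $\{0,-1,-2,\dots\}$, and let $x,y,z\in\mathbb C$ satisfy $|x|<r$, $|y|<s$, $|z|<t$ for some real $r,s,t$ with $r+s+t+2\sqrt{rst}=1$. Let $c>\nu$ be real with $c>-\Re(b_1)$ and $c>-\Re(b_2)$ (the last two conditions hold automatically if $\Re(b_1),\Re(b_2)>0$). Then the series for $H_{B,p,\nu}$, and those for $H_B^{(s)}$ with $\Re(s)=c$, converge absolutely; the Mellin transform $\Phi(s)=\int_0^\infty q^{s-1}H_{B,q,\nu}(b_1,b_2,b_3;c_1,c_2,c_3;x,y,z)\,dq$ converges absolutely for $\Re(s)=c$; and $$H_{B,p,\nu}(b_1,b_2,b_3;c_1,c_2,c_3;x,y,z)=\frac1{2\pi i}\int_{c-i\infty}^{c+i\infty}p^{-s}\Phi(s)\,ds$$ $$=\frac{\pi^{-3/2}}{4i}\int_{c-i\infty}^{c+i\infty}\Big(\frac2p\Big)^{s}\,\Gamma\Big(\frac{s-\nu}2\Big)\Gamma\Big(\frac{s+\nu+1}2\Big)H_B^{(s)}(b_1,b_2,b_3;c_1,c_2,c_3;x,y,z)\,ds,$$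 where both integrals converge absolutely and complex powers have their principal values. -/

import Mathlib

open MeasureTheory

noncomputable section

namespace ExtendedSrivastava

/-- The Pochhammer symbol `(a)_n = a (a + 1) ⋯ (a + n - 1)`. -/
def poch (a : ℂ) (n : ℕ) : ℂ := (ascPochhammer ℂ n).eval a

/-- `a ∈ ℂ \ ℤ₀⁻`: the number `a` is not one of `0, -1, -2, …`. -/
def NotNonposInt (a : ℂ) : Prop := ∀ n : ℕ, a ≠ -(n : ℂ)

/-- The classical Beta function `B(α, β) = Γ(α) Γ(β) / Γ(α + β)`. -/
def betaFn (α β : ℂ) : ℂ := Complex.Gamma α * Complex.Gamma β / Complex.Gamma (α + β)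

/-- For `Re α, Re β > 0` it is Euler's integral `∫₀¹ t ^ (α - 1) (1 - t) ^ (β - 1) dt`. -/
theorem betaFn_eq_betaIntegral {α β : ℂ} (hα : 0 < α.re) (hβ : 0 < β.re) :
    betaFn α β = Complex.betaIntegral α β := by
  have h : Complex.Gamma (α + β) ≠ 0 :=
    Complex.Gamma_ne_zero_of_re_pos (by simpa using add_pos hα hβ)
  rw [betaFn, Complex.Gamma_mul_Gamma_eq_betaIntegral hα hβ, mul_div_cancel_left₀ _ h]

/-- The modified Bessel function of the second kind (Macdonald function) of real order `μ` in the
right half plane `Re w > 0`: `K_μ(w) = ∫₀^∞ exp (-w cosh u) cosh (μ u) du`. -/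
def besselK (μ : ℝ) (w : ℂ) : ℂ :=
  ∫ u in Set.Ioi (0 : ℝ), Complex.exp (-w * (Real.cosh u : ℂ)) * (Real.cosh (μ * u) : ℂ)

/-- The extended Beta function
`B_{p,ν}(α, β) = √(2p/π) ∫₀¹ t ^ (α - 3/2) (1 - t) ^ (β - 3/2) K_{ν + 1/2}(p / (t (1 - t))) dt`,
for `Re p > 0`. -/
def extBeta (p : ℂ) (ν : ℝ) (α β : ℂ) : ℂ :=
  (2 * p / (Real.pi : ℂ)) ^ (1 / 2 : ℂ) *
    ∫ t in (0 : ℝ)..1, (t : ℂ) ^ (α - 3 / 2) * ((1 - t : ℝ) : ℂ) ^ (β - 3 / 2) *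
      besselK (ν + 1 / 2) (p / ((t * (1 - t) : ℝ) : ℂ))

/-- The factor `(b₁ + b₂)_{2m+n+k} (b₃)_{n+k} / ((c₁)_m (c₂)_n (c₃)_k)
  · x ^ m / m! · y ^ n / n! · z ^ k / k!`. -/
def coeff (b₁ b₂ b₃ c₁ c₂ c₃ x y z : ℂ) (m n k : ℕ) : ℂ :=
  poch (b₁ + b₂) (2 * m + n + k) * poch b₃ (n + k) / (poch c₁ m * poch c₂ n * poch c₃ k) *
    (x ^ m / (m.factorial : ℂ)) * (y ^ n / (n.factorial : ℂ)) * (z ^ k / (k.factorial : ℂ))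

/-- The general term of the series for `H_B^{(a)}`. -/
def termHBa (a b₁ b₂ b₃ c₁ c₂ c₃ x y z : ℂ) (i : ℕ × ℕ × ℕ) : ℂ :=
  coeff b₁ b₂ b₃ c₁ c₂ c₃ x y z i.1 i.2.1 i.2.2 *
    (betaFn (b₁ + a + i.1 + i.2.2) (b₂ + a + i.1 + i.2.1) / betaFn b₁ b₂)

/-- `H_B^{(a)}(b₁, b₂, b₃; c₁, c₂, c₃; x, y, z)`, the sum over all `(m, n, k) ∈ ℕ³`. -/
def HBa (a b₁ b₂ b₃ c₁ c₂ c₃ x y z : ℂ) : ℂ :=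
  ∑' i : ℕ × ℕ × ℕ, termHBa a b₁ b₂ b₃ c₁ c₂ c₃ x y z i

/-- The general term of the series for `H_{B,p,ν}`. -/
def termHB (p : ℂ) (ν : ℝ) (b₁ b₂ b₃ c₁ c₂ c₃ x y z : ℂ) (i : ℕ × ℕ × ℕ) : ℂ :=
  coeff b₁ b₂ b₃ c₁ c₂ c₃ x y z i.1 i.2.1 i.2.2 *
    (extBeta p ν (b₁ + i.1 + i.2.2) (b₂ + i.1 + i.2.1) / betaFn b₁ b₂)

/-- The `(p, ν)`-extended Srivastava function `H_{B,p,ν}(b₁, b₂, b₃; c₁, c₂, c₃; x, y, z)`. -/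
def HB (p : ℂ) (ν : ℝ) (b₁ b₂ b₃ c₁ c₂ c₃ x y z : ℂ) : ℂ :=
  ∑' i : ℕ × ℕ × ℕ, termHB p ν b₁ b₂ b₃ c₁ c₂ c₃ x y z i

/-- The region of convergence: `|x| < r`, `|y| < s`, `|z| < t` with `r + s + t + 2√(rst) = 1`. -/
def InRegion (x y z : ℂ) : Prop :=
  ∃ r s t : ℝ, ‖x‖ < r ∧ ‖y‖ < s ∧ ‖z‖ < t ∧ r + s + t + 2 * Real.sqrt (r * s * t) = 1

/-- The point `c + iτ` of the vertical line `Re s = c`. -/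
def linePt (c τ : ℝ) : ℂ := (c : ℂ) + (τ : ℂ) * Complex.I

/-- `f` is (absolutely) integrable along the line `Re s = c`. -/
def LineIntegrable (c : ℝ) (f : ℂ → ℂ) : Prop := Integrable (fun τ : ℝ => f (linePt c τ))

/-- `∫_{c - i∞}^{c + i∞} f(s) ds`, where `s = c + iτ` and `ds = i dτ`. -/
def lineIntegral (c : ℝ) (f : ℂ → ℂ) : ℂ := ∫ τ : ℝ, f (linePt c τ) * Complex.I

end ExtendedSrivastava

end

/-! The theorem is Mellin inversion for q ↦ H_{B,pq,ν}, evaluated at q = 1. Inversion only sees real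
q, so placing p inside the function is what admits complex p; the resulting transform is p^{-s}
Φ(s).

The transform is explicit term by term. Inserting the integral for K_μ and swapping integrals leaves
the Laplace transform of a power and then ∫ cosh(u)^{-σ} cosh(μu) du, a Beta integral in disguise
(`hasMellin_besselK`). Scaling by t(1-t) and integrating over t turns B_{pq,ν}(α, β) into
`mellinFactor` times B(α+s, β+s) (`hasMellin_extBeta`), and summation produces H_B^{(s)}
(`hasMellin_HB`).

Three estimates justify this. The triple series converges because, up to subexponential factors, its
coefficients are products of three binomials, controlled on the region by
`triple_choose_mul_pow_le_one`. On Re s = c the values B_{p,ν}(α, β), their absolute Mellin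
integrals and B(α+s, β+s) are all bounded by B(Re α + c, Re β + c), with constants independent of α
and β, so the single summable `majorant` serves every interchange of sum, limit and integral.
Finally the two Gamma factors decay together like e^{-θ|τ|} for any θ < π/2, which beats the growth
e^{|arg p||τ|} of p^{-s} (`exists_norm_mellinFactor_le`). -/

namespace ExtendedSrivastava

/-! ### Growth of Pochhammer symbols -/

/-- A nonnegative sequence whose consecutive ratios are bounded by a sequence tending to `1` grows
more slowly than any geometric sequence of ratio `ρ > 1`. -/
theorem exists_le_mul_pow_of_ratio {u r : ℕ → ℝ} (hu : ∀ n, 0 ≤ u n)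
    (hur : ∀ᶠ n in Filter.atTop, u (n + 1) ≤ r n * u n)
    (hr : Filter.Tendsto r Filter.atTop (nhds 1)) {ρ : ℝ} (hρ : 1 < ρ) :
    ∃ C, 0 < C ∧ ∀ n, u n ≤ C * ρ ^ n := by
  obtain ⟨N, hN⟩ := Filter.eventually_atTop.1 (hur.and (hr.eventually_le_const hρ))
  have hρ0 : 0 < ρ := by linarith
  have hS : ∀ n, n ≤ N → u n ≤ ∑ i ∈ Finset.range (N + 1), u i := fun n hn =>
    Finset.single_le_sum (fun i _ => hu i) (Finset.mem_range.2 (by omega))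
  have hS0 : 0 ≤ ∑ i ∈ Finset.range (N + 1), u i := Finset.sum_nonneg fun i _ => hu i
  refine ⟨∑ i ∈ Finset.range (N + 1), u i + 1, by linarith, fun n => ?_⟩
  induction n with
  | zero => simpa using (hS 0 (Nat.zero_le _)).trans (by linarith)
  | succ n ih =>
    rcases le_or_gt (n + 1) N with h | h
    · calc u (n + 1) ≤ _ := hS _ h
        _ ≤ (∑ i ∈ Finset.range (N + 1), u i + 1) * 1 := by linarith
        _ ≤ _ := by gcongr; exact one_le_pow₀ hρ.le
    · obtain ⟨h1, h2⟩ := hN n (by omega)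
      calc u (n + 1) ≤ r n * u n := h1
        _ ≤ ρ * u n := by gcongr; exact hu n
        _ ≤ ρ * ((∑ i ∈ Finset.range (N + 1), u i + 1) * ρ ^ n) := by gcongr
        _ = _ := by ring

theorem poch_zero (a : ℂ) : poch a 0 = 1 := by simp [poch]

theorem poch_succ (a : ℂ) (n : ℕ) : poch a (n + 1) = poch a n * (a + n) := by
  simp [poch, ascPochhammer_succ_right]

theorem poch_ne_zero {a : ℂ} (ha : NotNonposInt a) (n : ℕ) : poch a n ≠ 0 := by
  induction n with
  | zero => simp [poch_zero]
  | succ n ih =>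
    rw [poch_succ]
    refine mul_ne_zero ih fun h => ha n ?_
    linear_combination h

theorem tendsto_norm_add_div (a : ℂ) :
    Filter.Tendsto (fun n : ℕ => ‖a + n‖ / (n + 1)) Filter.atTop (nhds 1) := by
  have h1 : Filter.Tendsto (fun n : ℕ => (a - 1) * ((1 / ((n : ℝ) + 1) : ℝ) : ℂ) + 1)
      Filter.atTop (nhds ((a - 1) * ((0 : ℝ) : ℂ) + 1)) :=
    (((Complex.continuous_ofReal.tendsto 0).comp
      tendsto_one_div_add_atTop_nhds_zero_nat).const_mul _).add_const _
  have h2 := h1.norm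
  simp only [Complex.ofReal_zero, mul_zero, zero_add, norm_one] at h2
  refine h2.congr fun n => ?_
  have hn : (0 : ℝ) < (n : ℝ) + 1 := by positivity
  have hn' : (n : ℂ) + 1 ≠ 0 := by exact_mod_cast hn.ne'
  have h3 : ‖(n : ℂ) + 1‖ = n + 1 := by
    rw [← abs_of_pos hn, ← Real.norm_eq_abs, ← Complex.norm_real]
    push_cast
    rfl
  rw [show ‖a + n‖ / (n + 1) = ‖(a + n) / (n + 1)‖ by rw [norm_div, h3]]
  congr 1
  push_cast
  field_simp
  ring

/-- Consecutive values of |(a)_n|/n! have ratio |a+n|/(n+1) → 1. Together with the reciprocal bound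
below, this lets every Pochhammer symbol be traded for a factorial at the cost of ρ^n with ρ > 1
arbitrarily close to 1. -/
theorem exists_norm_poch_le (a : ℂ) {ρ : ℝ} (hρ : 1 < ρ) :
    ∃ C, 0 < C ∧ ∀ n : ℕ, ‖poch a n‖ ≤ C * ρ ^ n * n.factorial := by
  have key (n : ℕ) : ‖poch a (n + 1)‖ / (n + 1).factorial ≤
      ‖a + n‖ / (n + 1) * (‖poch a n‖ / n.factorial) := by
    rw [poch_succ, norm_mul, Nat.factorial_succ]
    push_cast
    exact le_of_eq (by field_simp)
  obtain ⟨C, hC, h⟩ := exists_le_mul_pow_of_ratio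
    (u := fun n => ‖poch a n‖ / n.factorial) (fun n => by positivity)
    (Filter.Eventually.of_forall key) (tendsto_norm_add_div a) hρ
  exact ⟨C, hC, fun n => (div_le_iff₀ (by positivity)).1 (h n)⟩

theorem exists_norm_inv_poch_le {a : ℂ} (ha : NotNonposInt a) {ρ : ℝ} (hρ : 1 < ρ) :
    ∃ C, 0 < C ∧ ∀ n : ℕ, ‖(poch a n)⁻¹‖ ≤ C * ρ ^ n * (n.factorial : ℝ)⁻¹ := by
  have ht := (tendsto_norm_add_div a).inv₀ one_ne_zero
  rw [inv_one] at ht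
  have key (n : ℕ) : ‖(poch a (n + 1))⁻¹‖ * (n + 1).factorial ≤
      (‖a + n‖ / (n + 1))⁻¹ * (‖(poch a n)⁻¹‖ * n.factorial) := by
    have h1 : ‖poch a n‖ ≠ 0 := norm_ne_zero_iff.2 (poch_ne_zero ha n)
    have h2 : ‖a + n‖ ≠ 0 := norm_ne_zero_iff.2 fun h => ha n (by linear_combination h)
    rw [poch_succ, norm_inv, norm_inv, norm_mul, Nat.factorial_succ]
    push_cast
    exact le_of_eq (by field_simp)
  obtain ⟨C, hC, h⟩ := exists_le_mul_pow_of_ratio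
    (u := fun n => ‖(poch a n)⁻¹‖ * n.factorial) (fun n => by positivity)
    (Filter.Eventually.of_forall key) ht hρ
  refine ⟨C, hC, fun n => ?_⟩
  rw [← div_eq_mul_inv, le_div_iff₀ (by positivity)]
  exact h n

theorem Gamma_add_nat {a : ℂ} (ha : NotNonposInt a) (n : ℕ) :
    Complex.Gamma (a + n) = poch a n * Complex.Gamma a := by
  rw [poch, ← Complex.Gamma_add_nat_div_Gamma_eq a ha, div_mul_cancel₀]
  exact Complex.Gamma_ne_zero ha

theorem NotNonposInt.of_re_pos {a : ℂ} (ha : 0 < a.re) : NotNonposInt a := by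
  rintro n rfl
  have : (0 : ℝ) ≤ n := n.cast_nonneg
  simp at ha
  linarith

theorem betaFn_add_nat {a b : ℂ} (ha : 0 < a.re) (hb : 0 < b.re) (i j : ℕ) :
    betaFn (a + i) (b + j) = betaFn a b * (poch a i * poch b j * (poch (a + b) (i + j))⁻¹) := by
  have hab : NotNonposInt (a + b) := .of_re_pos (by simpa using add_pos ha hb)
  have h : a + i + (b + j) = a + b + ((i + j : ℕ) : ℂ) := by push_cast; ring
  rw [betaFn, betaFn, h, Gamma_add_nat (.of_re_pos ha), Gamma_add_nat (.of_re_pos hb),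
    Gamma_add_nat hab]
  have h1 := poch_ne_zero hab (i + j)
  have h2 := Complex.Gamma_ne_zero hab
  field_simp

/-! ### Convergence of the triple series -/

/-- This is a single term of the binomial expansion of (α + (1-α))^{m+n} = 1. -/
theorem choose_mul_pow_le_one {α : ℝ} (h0 : 0 ≤ α) (h1 : α ≤ 1) (m n : ℕ) :
    ((m + n).factorial / (m.factorial * n.factorial) : ℝ) * (α ^ m * (1 - α) ^ n) ≤ 1 := by
  have h2 : 0 ≤ 1 - α := by linarith
  have h := add_pow α (1 - α) (m + n)
  rw [add_sub_cancel, one_pow] at h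
  rw [← Nat.cast_add_choose]
  refine le_trans (le_of_eq ?_) ((Finset.single_le_sum (f := fun i =>
    α ^ i * (1 - α) ^ (m + n - i) * ((m + n).choose i : ℝ)) (fun i _ => by positivity)
    (Finset.mem_range.2 (by omega : m < m + n + 1))).trans h.symm.le)
  simp only [Nat.add_sub_cancel_left]
  ring

/-- Each binomial is bounded separately, with weights in the ratios (r+w):(s+w), (s+w):(t+w),
(t+w):(r+w), where w = √(rst). The normalisation gives (r+w)² = r(1-s)(1-t) and its cyclic
analogues, so the six weights recombine exactly into r^m s^n t^k. -/
theorem triple_choose_mul_pow_le_one {r s t : ℝ} (hr : 0 < r) (hs : 0 < s) (ht : 0 < t)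
    (h : r + s + t + 2 * Real.sqrt (r * s * t) = 1) (m n k : ℕ) :
    ((m + n).factorial / (m.factorial * n.factorial) *
      ((n + k).factorial / (n.factorial * k.factorial)) *
      ((k + m).factorial / (k.factorial * m.factorial)) : ℝ) * (r ^ m * s ^ n * t ^ k) ≤ 1 := by
  set w := Real.sqrt (r * s * t) with hw
  have hw2 : w ^ 2 = r * s * t := Real.sq_sqrt (by positivity)
  have hw0 : 0 < w := Real.sqrt_pos.2 (by positivity)
  have hα := choose_mul_pow_le_one (α := (r + w) / (r + s + 2 * w)) (by positivity)
    ((div_le_one (by positivity)).2 (by linarith)) m n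
  have hβ := choose_mul_pow_le_one (α := (s + w) / (s + t + 2 * w)) (by positivity)
    ((div_le_one (by positivity)).2 (by linarith)) n k
  have hγ := choose_mul_pow_le_one (α := (t + w) / (t + r + 2 * w)) (by positivity)
    ((div_le_one (by positivity)).2 (by linarith)) k m
  have e1 : 1 - (r + w) / (r + s + 2 * w) = (s + w) / (r + s + 2 * w) := by
    field_simp; ring
  have e2 : 1 - (s + w) / (s + t + 2 * w) = (t + w) / (s + t + 2 * w) := by
    field_simp; ring
  have e3 : 1 - (t + w) / (t + r + 2 * w) = (r + w) / (t + r + 2 * w) := by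
    field_simp; ring
  rw [e1] at hα
  rw [e2] at hβ
  rw [e3] at hγ
  have f1 : (r + w) / (r + s + 2 * w) * ((r + w) / (t + r + 2 * w)) = r := by
    rw [show r + s + 2 * w = 1 - t by linarith, show t + r + 2 * w = 1 - s by linarith,
      div_mul_div_comm, div_eq_iff (mul_ne_zero (by linarith) (by linarith))]
    linear_combination hw2 + r * h
  have f2 : (s + w) / (r + s + 2 * w) * ((s + w) / (s + t + 2 * w)) = s := by
    rw [show r + s + 2 * w = 1 - t by linarith, show s + t + 2 * w = 1 - r by linarith,
      div_mul_div_comm, div_eq_iff (mul_ne_zero (by linarith) (by linarith))]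
    linear_combination hw2 + s * h
  have f3 : (t + w) / (s + t + 2 * w) * ((t + w) / (t + r + 2 * w)) = t := by
    rw [show s + t + 2 * w = 1 - r by linarith, show t + r + 2 * w = 1 - s by linarith,
      div_mul_div_comm, div_eq_iff (mul_ne_zero (by linarith) (by linarith))]
    linear_combination hw2 + t * h
  have g1 := congrArg (· ^ m) f1
  have g2 := congrArg (· ^ n) f2
  have g3 := congrArg (· ^ k) f3
  simp only [mul_pow] at g1 g2 g3
  have hprod := mul_le_one₀ (mul_le_one₀ hα (by positivity) hβ) (by positivity) hγ
  refine le_trans (le_of_eq ?_) hprod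
  rw [← g1, ← g2, ← g3]
  ring

/-- Room to absorb the subexponential losses: the Pochhammer factors of one term cost ρ^{7m+5n+5k}
in total, hence the exponent 7. -/
theorem exists_ratio_of_lt {a b c r s t : ℝ} (h1 : a < r) (h2 : b < s) (h3 : c < t) :
    ∃ ρ : ℝ, 1 < ρ ∧ ρ ^ 7 * a < r ∧ ρ ^ 7 * b < s ∧ ρ ^ 7 * c < t := by
  have key (a r : ℝ) (h : a < r) : ∀ᶠ ρ : ℝ in nhdsWithin 1 (Set.Ioi 1), ρ ^ 7 * a < r := by
    have hc : Continuous fun ρ : ℝ => ρ ^ 7 * a := by fun_prop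
    have := hc.tendsto 1
    rw [one_pow, one_mul] at this
    exact (this.mono_left nhdsWithin_le_nhds).eventually_lt_const h
  obtain ⟨ρ, h, h'⟩ := ((key a r h1).and ((key b s h2).and ((key c t h3).and
    self_mem_nhdsWithin))).exists
  exact ⟨ρ, h'.2.2, h, h'.1, h'.2.1⟩

theorem summable_pow_mul_pow_mul_pow {a b c : ℝ} (ha : 0 ≤ a) (hb : 0 ≤ b) (hc : 0 ≤ c)
    (ha1 : a < 1) (hb1 : b < 1) (hc1 : c < 1) :
    Summable fun i : ℕ × ℕ × ℕ => a ^ i.1 * (b ^ i.2.1 * c ^ i.2.2) := by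
  have h1 := (summable_geometric_of_lt_one hb hb1).mul_of_nonneg
    (summable_geometric_of_lt_one hc hc1) (fun n => by positivity) (fun n => by positivity)
  exact (summable_geometric_of_lt_one ha ha1).mul_of_nonneg h1 (fun n => by positivity)
    (fun n => by simp only [Pi.zero_apply]; positivity)

/-- After replacing Pochhammer symbols by factorials, (2m+n+k)! cancels against the denominator of
the Beta value, and what remains is exactly the product of three binomials. The Beta parameters are
independent of b₁, b₂, so the lemma covers both b + s and the real shifts Re b + c of the majorant.
-/
theorem summable_coeff_mul_betaFn (b₁ b₂ b₃ : ℂ) {c₁ c₂ c₃ x y z β₁ β₂ : ℂ}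
    (hc₁ : NotNonposInt c₁) (hc₂ : NotNonposInt c₂) (hc₃ : NotNonposInt c₃)
    (hxyz : InRegion x y z) (hβ₁ : 0 < β₁.re) (hβ₂ : 0 < β₂.re) :
    Summable fun i : ℕ × ℕ × ℕ => coeff b₁ b₂ b₃ c₁ c₂ c₃ x y z i.1 i.2.1 i.2.2 *
      betaFn (β₁ + i.1 + i.2.2) (β₂ + i.1 + i.2.1) := by
  obtain ⟨r, s, t, hx, hy, hz, hrst⟩ := hxyz
  have hr : 0 < r := (norm_nonneg x).trans_lt hx
  have hs : 0 < s := (norm_nonneg y).trans_lt hy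
  have ht : 0 < t := (norm_nonneg z).trans_lt hz
  obtain ⟨ρ, hρ, hx', hy', hz'⟩ := exists_ratio_of_lt hx hy hz
  have hβ₁₂ : NotNonposInt (β₁ + β₂) := .of_re_pos (by simpa using add_pos hβ₁ hβ₂)
  obtain ⟨A₁, hA₁, h₁⟩ := exists_norm_poch_le (b₁ + b₂) hρ
  obtain ⟨A₂, hA₂, h₂⟩ := exists_norm_poch_le b₃ hρ
  obtain ⟨A₃, hA₃, h₃⟩ := exists_norm_inv_poch_le hc₁ hρ
  obtain ⟨A₄, hA₄, h₄⟩ := exists_norm_inv_poch_le hc₂ hρ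
  obtain ⟨A₅, hA₅, h₅⟩ := exists_norm_inv_poch_le hc₃ hρ
  obtain ⟨A₆, hA₆, h₆⟩ := exists_norm_poch_le β₁ hρ
  obtain ⟨A₇, hA₇, h₇⟩ := exists_norm_poch_le β₂ hρ
  obtain ⟨A₈, hA₈, h₈⟩ := exists_norm_inv_poch_le hβ₁₂ hρ
  have hρ0 : 0 < ρ := by linarith
  set K := A₁ * A₂ * A₃ * A₄ * A₅ * A₆ * A₇ * A₈ * ‖betaFn β₁ β₂‖ with hK
  refine .of_norm_bounded (g := fun i : ℕ × ℕ × ℕ => K * ((ρ ^ 7 * ‖x‖ / r) ^ i.1 *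
    ((ρ ^ 7 * ‖y‖ / s) ^ i.2.1 * (ρ ^ 7 * ‖z‖ / t) ^ i.2.2))) (.mul_left _
    (summable_pow_mul_pow_mul_pow (by positivity) (by positivity) (by positivity)
      ((div_lt_one hr).2 hx') ((div_lt_one hs).2 hy') ((div_lt_one ht).2 hz'))) ?_
  rintro ⟨m, n, k⟩
  simp only
  have e1 : β₁ + m + k = β₁ + ((m + k : ℕ) : ℂ) := by push_cast; ring
  have e2 : β₂ + m + n = β₂ + ((m + n : ℕ) : ℂ) := by push_cast; ring
  rw [e1, e2, betaFn_add_nat hβ₁ hβ₂, coeff, div_eq_mul_inv]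
  simp only [mul_inv]
  simp only [norm_mul, norm_div, norm_pow, Complex.norm_natCast]
  calc _ ≤ (A₁ * ρ ^ (2 * m + n + k) * (2 * m + n + k).factorial) *
        (A₂ * ρ ^ (n + k) * (n + k).factorial) *
        ((A₃ * ρ ^ m * (m.factorial : ℝ)⁻¹) * (A₄ * ρ ^ n * (n.factorial : ℝ)⁻¹) *
        (A₅ * ρ ^ k * (k.factorial : ℝ)⁻¹)) * (‖x‖ ^ m / m.factorial) * (‖y‖ ^ n / n.factorial) *
        (‖z‖ ^ k / k.factorial) * (‖betaFn β₁ β₂‖ * ((A₆ * ρ ^ (m + k) * (m + k).factorial) *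
        (A₇ * ρ ^ (m + n) * (m + n).factorial) *
        (A₈ * ρ ^ (m + k + (m + n)) * ((m + k + (m + n)).factorial : ℝ)⁻¹))) := by
        gcongr
        · exact h₁ _
        · exact h₂ _
        · exact h₃ _
        · exact h₄ _
        · exact h₅ _
        · exact h₆ _
        · exact h₇ _
        · exact h₈ _
    _ = K * (((m + n).factorial / (m.factorial * n.factorial) *
      ((n + k).factorial / (n.factorial * k.factorial)) *
      ((k + m).factorial / (k.factorial * m.factorial)) : ℝ) * (r ^ m * s ^ n * t ^ k)) *
        (ρ ^ (7 * m + 5 * n + 5 * k) * ((‖x‖ / r) ^ m * ((‖y‖ / s) ^ n * (‖z‖ / t) ^ k))) := by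
        have hf : ((m + k + (m + n)).factorial : ℝ) = (2 * m + n + k).factorial := by
          congr 2; ring
        have hf' : ((m + k).factorial : ℝ) = (k + m).factorial := by
          congr 2; ring
        rw [hf, hf', hK]
        have e : ρ ^ (7 * m + 5 * n + 5 * k) = ρ ^ (2 * m + n + k) * ρ ^ (n + k) * (ρ ^ m *
          ρ ^ n * ρ ^ k) * (ρ ^ (m + k) * ρ ^ (m + n) * ρ ^ (m + k + (m + n))) := by ring
        rw [e]
        simp only [div_pow]
        field_simp
    _ ≤ K * 1 * (ρ ^ (7 * m + 7 * n + 7 * k) *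
          ((‖x‖ / r) ^ m * ((‖y‖ / s) ^ n * (‖z‖ / t) ^ k))) := by
        gcongr ?_ * ?_ * (?_ * ?_)
        · exact triple_choose_mul_pow_le_one hr hs ht hrst m n k
        · exact pow_le_pow_right₀ hρ.le (by omega)
    _ = _ := by
        have e : ρ ^ (7 * m + 7 * n + 7 * k) = (ρ ^ 7) ^ m * ((ρ ^ 7) ^ n * (ρ ^ 7) ^ k) := by
          ring
        rw [e]
        simp only [div_pow, mul_pow]
        ring

/-! ### Laplace transform of powers and decay of the Gamma function -/

theorem integrableOn_rpow_mul_exp_neg {a b : ℝ} (ha : -1 < a) (hb : 0 < b) :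
    IntegrableOn (fun t : ℝ => t ^ a * Real.exp (-(b * t))) (Set.Ioi 0) := by
  simpa using integrableOn_rpow_mul_exp_neg_mul_rpow ha one_pos hb

theorem norm_cpow_mul_exp (a r : ℂ) {t : ℝ} (ht : 0 < t) :
    ‖(t : ℂ) ^ a * Complex.exp (-(r * t))‖ = t ^ a.re * Real.exp (-(r.re * t)) := by
  rw [norm_mul, Complex.norm_cpow_eq_rpow_re_of_pos ht, Complex.norm_exp]
  simp

theorem continuousOn_cpow_mul_exp (a r : ℂ) :
    ContinuousOn (fun t : ℝ => (t : ℂ) ^ a * Complex.exp (-(r * t))) (Set.Ioi 0) := by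
  refine ContinuousOn.mul (fun t ht => ?_) (by fun_prop)
  exact (Complex.continuousAt_ofReal_cpow_const _ _ (Or.inr (ne_of_gt ht))).continuousWithinAt

theorem integrableOn_cpow_mul_exp_neg {a r : ℂ} (ha : -1 < a.re) (hr : 0 < r.re) :
    IntegrableOn (fun t : ℝ => (t : ℂ) ^ a * Complex.exp (-(r * t))) (Set.Ioi 0) := by
  refine (integrableOn_rpow_mul_exp_neg ha hr).mono'
    ((continuousOn_cpow_mul_exp a r).aestronglyMeasurable measurableSet_Ioi) ?_
  exact (ae_restrict_iff' measurableSet_Ioi).2 (.of_forall fun t ht =>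
    (norm_cpow_mul_exp a r ht).le)

theorem differentiableAt_integral_cpow_mul_exp_neg {a r₀ : ℂ} (ha : 0 < a.re) (hr₀ : 0 < r₀.re) :
    DifferentiableAt ℂ
      (fun r : ℂ => ∫ t : ℝ in Set.Ioi 0, (t : ℂ) ^ (a - 1) * Complex.exp (-(r * t))) r₀ := by
  have hopen : {r : ℂ | r₀.re / 2 < r.re} ∈ nhds r₀ :=
    (isOpen_lt continuous_const Complex.continuous_re).mem_nhds (by simpa using by linarith)
  refine (hasDerivAt_integral_of_dominated_loc_of_deriv_le (𝕜 := ℂ)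
    (μ := volume.restrict (Set.Ioi (0 : ℝ)))
    (F := fun r t => (t : ℂ) ^ (a - 1) * Complex.exp (-(r * t)))
    (F' := fun r t => -((t : ℂ) ^ a * Complex.exp (-(r * t))))
    (bound := fun t => t ^ a.re * Real.exp (-(r₀.re / 2 * t)))
    hopen ?_ ?_ ?_ ?_ ?_ ?_).2.differentiableAt
  · exact .of_forall fun r =>
      (continuousOn_cpow_mul_exp (a - 1) r).aestronglyMeasurable measurableSet_Ioi
  · exact integrableOn_cpow_mul_exp_neg (by simpa using ha) hr₀
  · exact ((continuousOn_cpow_mul_exp a r₀).aestronglyMeasurable measurableSet_Ioi).neg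
  · refine (ae_restrict_iff' measurableSet_Ioi).2 (.of_forall fun t ht r hr => ?_)
    have ht' : 0 < t := ht
    have hr' : r₀.re / 2 < r.re := hr
    rw [norm_neg, norm_cpow_mul_exp a r ht]
    gcongr
  · exact integrableOn_rpow_mul_exp_neg (by linarith) (by linarith)
  · refine (ae_restrict_iff' measurableSet_Ioi).2 (.of_forall fun t ht r _ => ?_)
    have ht' : (t : ℂ) ≠ 0 := by exact_mod_cast ne_of_gt ht
    have h1 : HasDerivAt (fun r : ℂ => -(r * t)) (-(1 * (t : ℂ))) r :=
      ((hasDerivAt_id r).mul_const _).neg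
    refine (h1.cexp.const_mul ((t : ℂ) ^ (a - 1))).congr_deriv ?_
    rw [Complex.cpow_sub _ _ ht', Complex.cpow_one]
    field_simp

/-- The Laplace transform of a complex power, on the right half plane. -/
theorem integral_cpow_mul_exp_neg {a r : ℂ} (ha : 0 < a.re) (hr : 0 < r.re) :
    ∫ t : ℝ in Set.Ioi 0, (t : ℂ) ^ (a - 1) * Complex.exp (-(r * t)) =
      r ^ (-a) * Complex.Gamma a := by
  have hopen : IsOpen {r : ℂ | 0 < r.re} := isOpen_lt continuous_const Complex.continuous_re
  have hf : AnalyticOnNhd ℂ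
      (fun r : ℂ => ∫ t : ℝ in Set.Ioi 0, (t : ℂ) ^ (a - 1) * Complex.exp (-(r * t)))
      {r : ℂ | 0 < r.re} :=
    DifferentiableOn.analyticOnNhd (fun r hr =>
      (differentiableAt_integral_cpow_mul_exp_neg ha hr).differentiableWithinAt) hopen
  have hg : AnalyticOnNhd ℂ (fun r : ℂ => r ^ (-a) * Complex.Gamma a) {r : ℂ | 0 < r.re} :=
    DifferentiableOn.analyticOnNhd (fun r hr => ((differentiableAt_id.cpow
      (differentiableAt_const _) (Or.inl hr)).mul_const _).differentiableWithinAt) hopen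
  -- Identity theorem: both sides are analytic in r and agree at the real points 1 + 1/(n+1), which
  -- accumulate at 1.
  refine hf.eqOn_of_preconnected_of_frequently_eq hg
    (convex_halfSpace_re_gt 0).isPreconnected (z₀ := 1) (by simp) ?_ hr
  have ht : Filter.Tendsto (fun n : ℕ => (((1 : ℝ) / ((n : ℝ) + 1) + 1 : ℝ) : ℂ)) Filter.atTop
      (nhdsWithin 1 {1}ᶜ) := by
    refine tendsto_nhdsWithin_iff.2 ⟨?_, .of_forall fun n => ?_⟩
    · have := (Complex.continuous_ofReal.tendsto _).comp
        ((tendsto_one_div_add_atTop_nhds_zero_nat (𝕜 := ℝ)).add_const 1)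
      rw [zero_add, Complex.ofReal_one] at this
      exact this
    · have : (1 : ℝ) / ((n : ℝ) + 1) + 1 ≠ 1 := by
        have : (0 : ℝ) < 1 / ((n : ℝ) + 1) := by positivity
        linarith
      simpa only [Set.mem_compl_iff, Set.mem_singleton_iff, Complex.ofReal_eq_one] using this
  refine ht.frequently (.of_forall fun n => ?_)
  have hpos : (0 : ℝ) < 1 / ((n : ℝ) + 1) + 1 := by positivity
  rw [Complex.integral_cpow_mul_exp_neg_mul_Ioi ha hpos, one_div, Complex.inv_cpow,
    Complex.cpow_neg]
  rw [Complex.arg_ofReal_of_nonneg hpos.le]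
  exact Real.pi_pos.ne

/-- Exponential decay of the Gamma function on vertical lines. -/
theorem exp_mul_norm_Gamma_le {s : ℂ} (hs : 0 < s.re) {θ : ℝ} (h1 : -(Real.pi / 2) < θ)
    (h2 : θ < Real.pi / 2) :
    Real.exp (θ * s.im) * ‖Complex.Gamma s‖ ≤ (1 / Real.cos θ) ^ s.re * Real.Gamma s.re := by
  have hcos : 0 < Real.cos θ := Real.cos_pos_of_mem_Ioo ⟨h1, h2⟩
  have hre : (Complex.exp (θ * Complex.I)).re = Real.cos θ := Complex.exp_ofReal_mul_I_re θ
  have harg : (Complex.exp (θ * Complex.I)).arg = θ := by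
    rw [Complex.arg_exp_mul_I, toIocMod_eq_self]
    constructor <;> linarith [Real.pi_pos]
  -- Taking r = e^{iθ} on the unit circle gives |r^{-s}| = e^{θ Im s}, while the absolute integral
  -- only sees Re r = cos θ > 0.
  have h := integral_cpow_mul_exp_neg (r := Complex.exp (θ * Complex.I)) hs (hre ▸ hcos)
  have hn : Real.exp (θ * s.im) * ‖Complex.Gamma s‖ =
      ‖Complex.exp (θ * Complex.I) ^ (-s) * Complex.Gamma s‖ := by
    rw [norm_mul, Complex.norm_cpow_of_ne_zero (Complex.exp_ne_zero _), harg,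
      Complex.norm_exp_ofReal_mul_I, Real.one_rpow, Complex.neg_im, mul_neg, Real.exp_neg,
      one_div, inv_inv]
  rw [hn, ← h, ← Real.integral_rpow_mul_exp_neg_mul_Ioi hs hcos]
  refine (norm_integral_le_integral_norm _).trans (le_of_eq ?_)
  refine setIntegral_congr_fun measurableSet_Ioi fun t ht => ?_
  rw [norm_cpow_mul_exp _ _ ht, hre]
  simp

theorem norm_Gamma_le_exp {s : ℂ} (hs : 0 < s.re) {θ : ℝ} (h1 : 0 ≤ θ) (h2 : θ < Real.pi / 2) :
    ‖Complex.Gamma s‖ ≤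
      (1 / Real.cos θ) ^ s.re * Real.Gamma s.re * Real.exp (-(θ * |s.im|)) := by
  rw [Real.exp_neg, ← div_eq_mul_inv, le_div_iff₀ (Real.exp_pos _), mul_comm]
  rcases abs_cases s.im with ⟨h, _⟩ | ⟨h, _⟩
  · rw [h]
    exact exp_mul_norm_Gamma_le hs (by linarith) h2
  · rw [h, mul_neg, ← neg_mul, ← Real.cos_neg]
    exact exp_mul_norm_Gamma_le hs (by linarith) (by linarith)

/-! ### Bounds and continuity of K_μ -/

theorem cosh_le_exp_abs (x : ℝ) : Real.cosh x ≤ Real.exp |x| := by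
  rw [← Real.cosh_abs, Real.cosh_eq]
  have : Real.exp (-|x|) ≤ Real.exp |x| := Real.exp_le_exp.2 (by linarith [abs_nonneg x])
  linarith

theorem exp_half_le_cosh (x : ℝ) : Real.exp x / 2 ≤ Real.cosh x := by
  rw [Real.cosh_eq]
  linarith [Real.exp_pos (-x)]

theorem integrableOn_cosh_rpow_mul_cosh {μ M : ℝ} (hμ : 0 ≤ μ) (hM : μ < M) :
    IntegrableOn (fun u : ℝ => Real.cosh u ^ (-M) * Real.cosh (μ * u)) (Set.Ioi 0) := by
  have hb := (exp_neg_integrableOn_Ioi 0 (sub_pos.2 hM)).const_mul ((2 : ℝ) ^ M)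
  refine hb.mono' (Continuous.aestronglyMeasurable ?_) ?_
  · refine (Real.continuous_cosh.rpow_const fun u => Or.inl (Real.cosh_pos u).ne').mul ?_
    exact Real.continuous_cosh.comp (by fun_prop)
  · refine (ae_restrict_iff' measurableSet_Ioi).2 (.of_forall fun u hu => ?_)
    have hu' : 0 < u := hu
    have hc := Real.cosh_pos u
    have hc' := Real.cosh_pos (μ * u)
    rw [Real.norm_of_nonneg (by positivity)]
    calc Real.cosh u ^ (-M) * Real.cosh (μ * u)
        ≤ (Real.exp u / 2) ^ (-M) * Real.exp (μ * u) := by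
          gcongr ?_ * ?_
          · exact Real.rpow_le_rpow_of_nonpos (by positivity) (exp_half_le_cosh u) (by linarith)
          · refine (cosh_le_exp_abs _).trans_eq ?_
            rw [abs_of_nonneg (by positivity)]
      _ = 2 ^ M * Real.exp (-(M - μ) * u) := by
          rw [Real.div_rpow (Real.exp_pos u).le two_pos.le, Real.rpow_neg two_pos.le, div_inv_eq_mul,
            ← Real.exp_mul, mul_comm (Real.exp _), mul_assoc, ← Real.exp_add]
          congr 2
          ring

/-- Raise v/M ≤ e^{v/M} to the power M. -/
theorem exp_neg_le_mul_rpow_neg {M v : ℝ} (hM : 0 < M) (hv : 0 < v) :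
    Real.exp (-v) ≤ M ^ M * v ^ (-M) := by
  have h : v / M ≤ Real.exp (v / M) := by linarith [Real.add_one_le_exp (v / M)]
  have h2 := Real.rpow_le_rpow (by positivity) h hM.le
  rw [Real.div_rpow hv.le hM.le, ← Real.exp_mul, div_mul_cancel₀ _ hM.ne',
    div_le_iff₀ (by positivity)] at h2
  rw [Real.exp_neg, Real.rpow_neg hv.le, ← div_eq_mul_inv, le_div_iff₀ (by positivity),
    inv_mul_le_iff₀ (Real.exp_pos _)]
  exact h2

theorem norm_exp_neg_mul_cosh (μ : ℝ) (w : ℂ) (u : ℝ) :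
    ‖Complex.exp (-w * (Real.cosh u : ℂ)) * (Real.cosh (μ * u) : ℂ)‖ =
      Real.exp (-(w.re * Real.cosh u)) * Real.cosh (μ * u) := by
  rw [norm_mul, Complex.norm_exp, Complex.norm_real, Real.norm_of_nonneg (Real.cosh_pos _).le,
    Complex.re_mul_ofReal, Complex.neg_re, neg_mul]

theorem norm_exp_neg_mul_cosh_le {μ M : ℝ} (hM : 0 < M) {w : ℂ} {a : ℝ} (ha : 0 < a)
    (hw : a ≤ w.re) (u : ℝ) :
    ‖Complex.exp (-w * (Real.cosh u : ℂ)) * (Real.cosh (μ * u) : ℂ)‖ ≤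
      M ^ M * a ^ (-M) * (Real.cosh u ^ (-M) * Real.cosh (μ * u)) := by
  rw [norm_exp_neg_mul_cosh, ← mul_assoc]
  have hc := Real.cosh_pos u
  have hc' := Real.cosh_pos (μ * u)
  gcongr
  rw [mul_assoc, ← Real.mul_rpow ha.le hc.le]
  refine le_trans ?_ (exp_neg_le_mul_rpow_neg hM (by positivity))
  gcongr

/-- Trading e^{-w cosh u} for a power separates w from u, leaving an integral over u that converges
because M > μ. A pure power of Re w is the useful form: inserted in the extended Beta function it
yields an ordinary Beta integral. -/
theorem exists_norm_besselK_le {μ M : ℝ} (hμ : 0 ≤ μ) (hM : μ < M) :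
    ∃ C, 0 ≤ C ∧ ∀ w : ℂ, 0 < w.re → ‖besselK μ w‖ ≤ C * w.re ^ (-M) := by
  refine ⟨M ^ M * ∫ u in Set.Ioi (0 : ℝ), Real.cosh u ^ (-M) * Real.cosh (μ * u), ?_,
    fun w hw => ?_⟩
  · have : 0 ≤ M := by linarith
    refine mul_nonneg (by positivity) (integral_nonneg fun u => ?_)
    have hc := Real.cosh_pos u
    have hc' := Real.cosh_pos (μ * u)
    simp only [Pi.zero_apply]
    positivity
  · have := norm_integral_le_of_norm_le
      ((integrableOn_cosh_rpow_mul_cosh hμ hM).const_mul (M ^ M * w.re ^ (-M)))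
      (.of_forall fun u => norm_exp_neg_mul_cosh_le (μ := μ) (hμ.trans_lt hM) hw le_rfl u)
    refine this.trans_eq ?_
    rw [integral_const_mul]
    ring

theorem continuousOn_besselK {μ : ℝ} (hμ : 0 ≤ μ) :
    ContinuousOn (besselK μ) {w : ℂ | 0 < w.re} := by
  intro w₀ hw₀
  have hw₀' : 0 < w₀.re := hw₀
  refine ContinuousAt.continuousWithinAt (continuousAt_of_dominated
    (bound := fun u => (μ + 1) ^ (μ + 1) * (w₀.re / 2) ^ (-(μ + 1)) *
      (Real.cosh u ^ (-(μ + 1)) * Real.cosh (μ * u))) ?_ ?_ ?_ ?_)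
  · exact .of_forall fun w => Continuous.aestronglyMeasurable (by fun_prop)
  · have hopen : {r : ℂ | w₀.re / 2 < r.re} ∈ nhds w₀ :=
      (isOpen_lt continuous_const Complex.continuous_re).mem_nhds (by simpa using by linarith)
    filter_upwards [hopen] with w hw
    exact .of_forall fun u => norm_exp_neg_mul_cosh_le (by linarith) (by linarith) (le_of_lt hw) u
  · exact (integrableOn_cosh_rpow_mul_cosh hμ (lt_add_one μ)).const_mul _
  · exact .of_forall fun u => by fun_prop

/-! ### Mellin transform of K_μ -/

/-- The sigmoid S satisfies S' = S(1-S), so the substitution t = S(v) in Euler's integral raises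
both exponents by one and moves it to the whole real line. -/
theorem abs_deriv_smul_sigmoid (a b : ℂ) (v : ℝ) :
    |Real.sigmoid v * (1 - Real.sigmoid v)| • ((Real.sigmoid v : ℂ) ^ (a - 1) *
      (1 - (Real.sigmoid v : ℂ)) ^ (b - 1)) =
    (Real.sigmoid v : ℂ) ^ a * ((1 - Real.sigmoid v : ℝ) : ℂ) ^ b := by
  have h0 := Real.sigmoid_pos v
  have h1 : 0 < 1 - Real.sigmoid v := by linarith [Real.sigmoid_lt_one v]
  have h0' : (Real.sigmoid v : ℂ) ≠ 0 := by exact_mod_cast h0.ne'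
  have h1' : (1 - (Real.sigmoid v : ℂ)) ≠ 0 := by exact_mod_cast h1.ne'
  rw [abs_of_pos (mul_pos h0 h1), Complex.real_smul, Complex.cpow_sub _ _ h0',
    Complex.cpow_sub _ _ (by exact_mod_cast h1.ne'), Complex.cpow_one, Complex.cpow_one]
  push_cast
  field_simp

theorem image_sigmoid : Real.sigmoid '' Set.univ = Set.Ioo 0 1 := by
  rw [Set.image_univ, Real.range_sigmoid]

theorem integrable_sigmoid_cpow {a b : ℂ} (ha : 0 < a.re) (hb : 0 < b.re) :
    Integrable fun v : ℝ =>
      (Real.sigmoid v : ℂ) ^ a * ((1 - Real.sigmoid v : ℝ) : ℂ) ^ b := by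
  have h := Complex.betaIntegral_convergent ha hb
  rw [intervalIntegrable_iff_integrableOn_Ioo_of_le zero_le_one, ← image_sigmoid,
    integrableOn_image_iff_integrableOn_abs_deriv_smul MeasurableSet.univ
      (fun v _ => (Real.hasDerivAt_sigmoid v).hasDerivWithinAt)
      Real.sigmoid_injective.injOn, integrableOn_univ] at h
  exact h.congr (.of_forall fun v => abs_deriv_smul_sigmoid a b v)

theorem integral_sigmoid_cpow (a b : ℂ) :
    ∫ v : ℝ, (Real.sigmoid v : ℂ) ^ a * ((1 - Real.sigmoid v : ℝ) : ℂ) ^ b =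
      Complex.betaIntegral a b := by
  rw [Complex.betaIntegral, intervalIntegral.integral_of_le zero_le_one,
    integral_Ioc_eq_integral_Ioo, ← image_sigmoid,
    integral_image_eq_integral_abs_deriv_smul MeasurableSet.univ
      (fun v _ => (Real.hasDerivAt_sigmoid v).hasDerivWithinAt)
      Real.sigmoid_injective.injOn, setIntegral_univ]
  exact integral_congr_ae (.of_forall fun v => (abs_deriv_smul_sigmoid a b v).symm)

theorem sigmoid_eq_exp_div_cosh (v : ℝ) :
    Real.sigmoid v = Real.exp (v / 2) / (2 * Real.cosh (v / 2)) := by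
  have h : Real.exp (v / 2) * Real.exp (-v) = Real.exp (-(v / 2)) := by
    rw [← Real.exp_add]; congr 1; ring
  have h1 := Real.exp_pos (v / 2)
  have h2 := Real.exp_pos (-v)
  rw [Real.sigmoid_def, Real.cosh_eq, ← h]
  field_simp

theorem ofReal_exp_div_cpow {C : ℝ} (hC : 0 < C) (x : ℝ) (a : ℂ) :
    ((Real.exp x / C : ℝ) : ℂ) ^ a = Complex.exp (x * a) * (C : ℂ) ^ (-a) := by
  have hC' : (C : ℂ) ≠ 0 := by exact_mod_cast hC.ne'
  have h : ((Real.exp x / C : ℝ) : ℂ) ≠ 0 := by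
    have := Real.exp_pos x
    exact_mod_cast (div_pos this hC).ne'
  rw [Complex.cpow_def_of_ne_zero h, Complex.cpow_def_of_ne_zero hC', ← Complex.exp_add,
    ← Complex.ofReal_log (by positivity), ← Complex.ofReal_log hC.le,
    Real.log_div (Real.exp_pos x).ne' hC.ne', Real.log_exp]
  congr 1
  push_cast
  ring

theorem sigmoid_cpow_eq (σ μ : ℂ) (v : ℝ) :
    (Real.sigmoid v : ℂ) ^ ((σ + μ) / 2) * ((1 - Real.sigmoid v : ℝ) : ℂ) ^ ((σ - μ) / 2) =
      ((2 * Real.cosh (v / 2) : ℝ) : ℂ) ^ (-σ) * Complex.exp (μ * (v / 2 : ℝ)) := by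
  have hC : 0 < 2 * Real.cosh (v / 2) := mul_pos two_pos (Real.cosh_pos _)
  have hC' : ((2 * Real.cosh (v / 2) : ℝ) : ℂ) ≠ 0 := by exact_mod_cast hC.ne'
  rw [← Real.sigmoid_neg, sigmoid_eq_exp_div_cosh, sigmoid_eq_exp_div_cosh, neg_div,
    Real.cosh_neg, ofReal_exp_div_cpow hC, ofReal_exp_div_cpow hC,
    mul_mul_mul_comm, ← Complex.exp_add, ← Complex.cpow_add _ _ hC', mul_comm]
  congr 2
  · ring
  · push_cast
    ring

/-- Since the sigmoid at ±v equals e^{±v/2}/(2 cosh(v/2)), Euler's integral with parameters (σ±μ)/2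
becomes ∫ (2 cosh u)^{-σ} e^{μu} over the line, with v = 2u. Folding at 0 replaces the exponential
by 2 cosh(μu). -/
theorem integral_cosh_cpow_mul_cosh {σ : ℂ} {μ : ℝ} (hμ : 0 ≤ μ) (hσ : μ < σ.re) :
    ∫ u in Set.Ioi (0 : ℝ), (Real.cosh u : ℂ) ^ (-σ) * (Real.cosh (μ * u) : ℂ) =
      2 ^ (σ - 2) * betaFn ((σ + μ) / 2) ((σ - μ) / 2) := by
  have ha : 0 < ((σ + μ) / 2).re := by
    rw [Complex.div_ofNat_re, Complex.add_re, Complex.ofReal_re]; linarith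
  have hb : 0 < ((σ - μ) / 2).re := by
    rw [Complex.div_ofNat_re, Complex.sub_re, Complex.ofReal_re]; linarith
  set f : ℝ → ℂ := fun u => ((2 * Real.cosh u : ℝ) : ℂ) ^ (-σ) * Complex.exp (μ * u) with hf
  have hfv (v : ℝ) : (Real.sigmoid v : ℂ) ^ ((σ + μ) / 2) *
      ((1 - Real.sigmoid v : ℝ) : ℂ) ^ ((σ - μ) / 2) = f (v / 2) := sigmoid_cpow_eq σ μ v
  have hint := integrable_sigmoid_cpow ha hb
  have hval := integral_sigmoid_cpow ((σ + μ) / 2) ((σ - μ) / 2)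
  simp only [hfv] at hint hval
  replace hint : Integrable f := (integrable_comp_div_iff f two_ne_zero).1 hint
  rw [Measure.integral_comp_div, abs_of_pos two_pos, ← betaFn_eq_betaIntegral ha hb,
    ← intervalIntegral.integral_Iic_add_Ioi hint.integrableOn hint.integrableOn (b := 0),
    ← neg_zero, ← integral_comp_neg_Ioi, neg_zero,
    ← integral_add hint.comp_neg.integrableOn hint.integrableOn] at hval
  rw [← hval, Complex.real_smul, ← integral_const_mul, ← integral_const_mul]
  refine integral_congr_ae (.of_forall fun u => ?_)
  -- The 1/4 cancels one factor 2 from v = 2u and another from e^{μu} + e^{-μu} = 2 cosh(μu).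
  have h2 : (2 : ℂ) ^ (σ - 2) * 2 ^ (-σ) = 1 / 4 := by
    rw [← Complex.cpow_add _ _ two_ne_zero, show σ - 2 + -σ = -(2 : ℕ) by push_cast; ring,
      Complex.cpow_neg, Complex.cpow_natCast]
    norm_num
  simp only [hf]
  rw [Real.cosh_neg, Complex.ofReal_mul, Complex.mul_cpow_ofReal_nonneg two_pos.le
    (Real.cosh_pos u).le, Complex.ofReal_cosh (μ * u), Complex.cosh]
  push_cast
  rw [mul_neg]
  linear_combination (-2 * (Complex.cosh u) ^ (-σ) * (Complex.exp (μ * u) +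
    Complex.exp (-(μ * u)))) * h2

theorem mul_ofReal_cpow {p : ℂ} (hp : p ≠ 0) {r : ℝ} (hr : 0 < r) (a : ℂ) :
    (p * r) ^ a = p ^ a * (r : ℂ) ^ a := by
  have hr' : (r : ℂ) ≠ 0 := by exact_mod_cast hr.ne'
  rw [Complex.cpow_def_of_ne_zero (mul_ne_zero hp hr'), Complex.cpow_def_of_ne_zero hp,
    Complex.cpow_def_of_ne_zero hr', Complex.log_mul_ofReal r hr p hp, ← Complex.exp_add,
    Complex.ofReal_log hr.le]
  congr 1
  ring

theorem continuousOn_ofReal_cpow (a : ℂ) :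
    ContinuousOn (fun q : ℝ => (q : ℂ) ^ a) (Set.Ioi 0) := fun _ hq =>
  (Complex.continuousAt_ofReal_cpow_const _ _ (Or.inr (ne_of_gt hq))).continuousWithinAt

/-- Tonelli with u outermost: the absolute q-integral is a real Gamma integral, leaving a constant
multiple of cosh(u)^{-Re σ} cosh(μu), integrable because Re σ > μ. -/
theorem integrable_besselK_mellin_kernel {p σ : ℂ} {μ : ℝ} (hp : 0 < p.re) (hμ : 0 ≤ μ)
    (hσ : μ < σ.re) :
    Integrable (Function.uncurry fun q u : ℝ => (q : ℂ) ^ (σ - 1) *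
      (Complex.exp (-(p * q) * (Real.cosh u : ℂ)) * (Real.cosh (μ * u) : ℂ)))
      ((volume.restrict (Set.Ioi (0 : ℝ))).prod (volume.restrict (Set.Ioi (0 : ℝ)))) := by
  have hσ0 : 0 < σ.re := hμ.trans_lt hσ
  have hrw (q u : ℝ) : (q : ℂ) ^ (σ - 1) *
      (Complex.exp (-(p * q) * (Real.cosh u : ℂ)) * (Real.cosh (μ * u) : ℂ)) =
      (q : ℂ) ^ (σ - 1) * Complex.exp (-(p * (Real.cosh u : ℂ) * q)) *
        (Real.cosh (μ * u) : ℂ) := by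
    rw [mul_assoc]; congr 3; ring
  have hre (u : ℝ) : 0 < (p * (Real.cosh u : ℂ)).re := by
    rw [Complex.re_mul_ofReal]; exact mul_pos hp (Real.cosh_pos u)
  refine (integrable_prod_iff' ?_).2 ⟨?_, ?_⟩
  · rw [Measure.prod_restrict]
    refine ContinuousOn.aestronglyMeasurable ?_ (measurableSet_Ioi.prod measurableSet_Ioi)
    refine ContinuousOn.mul ((continuousOn_ofReal_cpow _).comp continuousOn_fst
      fun x hx => hx.1) (by fun_prop)
  · refine .of_forall fun u => ?_
    simp only [Function.uncurry_apply_pair, hrw]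
    exact (integrableOn_cpow_mul_exp_neg (by simpa using hσ0) (hre u)).mul_const _
  · refine ((integrableOn_cosh_rpow_mul_cosh hμ hσ).const_mul
      ((1 / p.re) ^ σ.re * Real.Gamma σ.re)).congr (.of_forall fun u => ?_)
    simp only [Function.uncurry_apply_pair, hrw]
    have h (q : ℝ) (hq : q ∈ Set.Ioi (0 : ℝ)) : ‖(q : ℂ) ^ (σ - 1) *
        Complex.exp (-(p * (Real.cosh u : ℂ) * q)) * (Real.cosh (μ * u) : ℂ)‖ =
        q ^ (σ.re - 1) * Real.exp (-(p.re * Real.cosh u * q)) * Real.cosh (μ * u) := by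
      rw [norm_mul, norm_cpow_mul_exp _ _ hq, Complex.norm_real,
        Real.norm_of_nonneg (Real.cosh_pos _).le, Complex.re_mul_ofReal]
      simp
    rw [setIntegral_congr_fun measurableSet_Ioi h, integral_mul_const,
      Real.integral_rpow_mul_exp_neg_mul_Ioi hσ0 (mul_pos hp (Real.cosh_pos u)),
      ← one_div_mul_one_div, Real.mul_rpow (one_div_pos.2 hp).le
        (one_div_pos.2 (Real.cosh_pos u)).le, one_div (Real.cosh u),
      Real.inv_rpow (Real.cosh_pos u).le, Real.rpow_neg (Real.cosh_pos u).le]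
    ring

/-- The Mellin transform of `q ↦ K_μ(p q)`, for `Re p > 0`. -/
theorem hasMellin_besselK {p σ : ℂ} {μ : ℝ} (hp : 0 < p.re) (hμ : 0 ≤ μ) (hσ : μ < σ.re) :
    HasMellin (fun q : ℝ => besselK μ (p * q)) σ (p ^ (-σ) * (2 ^ (σ - 2) *
      (Complex.Gamma ((σ + μ) / 2) * Complex.Gamma ((σ - μ) / 2)))) := by
  have hσ0 : 0 < σ.re := hμ.trans_lt hσ
  have hp0 : p ≠ 0 := by rintro rfl; simp at hp
  have hint := integrable_besselK_mellin_kernel hp hμ hσ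
  have hbes (q : ℝ) : (∫ u in Set.Ioi (0 : ℝ), (q : ℂ) ^ (σ - 1) *
      (Complex.exp (-(p * q) * (Real.cosh u : ℂ)) * (Real.cosh (μ * u) : ℂ))) =
      (q : ℂ) ^ (σ - 1) • besselK μ (p * q) := by
    rw [integral_const_mul, smul_eq_mul, besselK]
  constructor
  · exact hint.integral_prod_left.congr (.of_forall fun q => hbes q)
  · rw [mellin, ← integral_congr_ae (.of_forall hbes), integral_integral_swap hint]
    have hin (u : ℝ) : (∫ q in Set.Ioi (0 : ℝ), (q : ℂ) ^ (σ - 1) *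
        (Complex.exp (-(p * q) * (Real.cosh u : ℂ)) * (Real.cosh (μ * u) : ℂ))) =
        p ^ (-σ) * Complex.Gamma σ * ((Real.cosh u : ℂ) ^ (-σ) * (Real.cosh (μ * u) : ℂ)) := by
      have hre : 0 < (p * (Real.cosh u : ℂ)).re := by
        rw [Complex.re_mul_ofReal]; exact mul_pos hp (Real.cosh_pos u)
      have h := integral_cpow_mul_exp_neg (r := p * (Real.cosh u : ℂ)) hσ0 hre
      rw [mul_ofReal_cpow hp0 (Real.cosh_pos u)] at h
      simp only [← mul_assoc]
      rw [integral_mul_const]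
      simp only [neg_mul, mul_right_comm p _ (Real.cosh u : ℂ)]
      rw [h]
      ring
    simp only [hin]
    rw [integral_const_mul, integral_cosh_cpow_mul_cosh hμ hσ, betaFn,
      show (σ + μ) / 2 + (σ - μ) / 2 = σ by ring]
    have := Complex.Gamma_ne_zero_of_re_pos hσ0
    field_simp

/-! ### Bounds and continuity of the extended Beta function -/

theorem norm_cpow_mul_one_sub_cpow (a b : ℂ) {t : ℝ} (ht : t ∈ Set.Ioo (0 : ℝ) 1) :
    ‖(t : ℂ) ^ a * ((1 - t : ℝ) : ℂ) ^ b‖ = t ^ a.re * (1 - t) ^ b.re := by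
  rw [norm_mul, Complex.norm_cpow_eq_rpow_re_of_pos ht.1,
    Complex.norm_cpow_eq_rpow_re_of_pos (sub_pos.2 ht.2)]

theorem continuousOn_cpow_mul_one_sub_cpow (a b : ℂ) :
    ContinuousOn (fun t : ℝ => (t : ℂ) ^ a * ((1 - t : ℝ) : ℂ) ^ b) (Set.Ioo 0 1) :=
  ((continuousOn_ofReal_cpow a).mono fun _ ht => ht.1).mul
    ((continuousOn_ofReal_cpow b).comp (by fun_prop) fun _ ht => sub_pos.2 ht.2)

theorem integrableOn_rpow_mul_one_sub_rpow {a b : ℝ} (ha : 0 < a) (hb : 0 < b) :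
    IntegrableOn (fun t : ℝ => t ^ (a - 1) * (1 - t) ^ (b - 1)) (Set.Ioo 0 1) := by
  have h := Complex.betaIntegral_convergent (u := a) (v := b) ha hb
  rw [intervalIntegrable_iff_integrableOn_Ioo_of_le zero_le_one] at h
  refine h.norm.congr ((ae_restrict_iff' measurableSet_Ioo).2 (.of_forall fun t ht => ?_))
  have := norm_cpow_mul_one_sub_cpow (a - 1) (b - 1) ht
  push_cast at this
  simpa using this

theorem integral_rpow_mul_one_sub_rpow {a b : ℝ} (ha : 0 < a) (hb : 0 < b) :
    ∫ t in Set.Ioo (0 : ℝ) 1, t ^ (a - 1) * (1 - t) ^ (b - 1) = ‖betaFn a b‖ := by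
  have h : betaFn a b = ((∫ t in Set.Ioo (0 : ℝ) 1, t ^ (a - 1) * (1 - t) ^ (b - 1) : ℝ) : ℂ) := by
    rw [betaFn_eq_betaIntegral ha hb, Complex.betaIntegral,
      intervalIntegral.integral_of_le zero_le_one, integral_Ioc_eq_integral_Ioo,
      ← integral_complex_ofReal]
    refine setIntegral_congr_fun measurableSet_Ioo fun t ht => ?_
    have h0 : 0 ≤ 1 - t := (sub_pos.2 ht.2).le
    rw [Complex.ofReal_mul, Complex.ofReal_cpow ht.1.le, Complex.ofReal_cpow h0]
    push_cast
    rfl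
  rw [h, Complex.norm_real, Real.norm_of_nonneg]
  refine setIntegral_nonneg measurableSet_Ioo fun t ht => ?_
  have h0 : 0 < 1 - t := sub_pos.2 ht.2
  have h1 : 0 < t := ht.1
  positivity

theorem norm_betaFn_le {α β : ℂ} (hα : 0 < α.re) (hβ : 0 < β.re) :
    ‖betaFn α β‖ ≤ ‖betaFn (α.re : ℂ) (β.re : ℂ)‖ := by
  rw [← integral_rpow_mul_one_sub_rpow hα hβ, betaFn_eq_betaIntegral hα hβ, Complex.betaIntegral,
    intervalIntegral.integral_of_le zero_le_one, integral_Ioc_eq_integral_Ioo]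
  refine norm_integral_le_of_norm_le (integrableOn_rpow_mul_one_sub_rpow hα hβ)
    ((ae_restrict_iff' measurableSet_Ioo).2 (.of_forall fun t ht => ?_))
  have := norm_cpow_mul_one_sub_cpow (α - 1) (β - 1) ht
  push_cast at this
  simpa using this.le

/-- The algebraic factor of the integrand of the extended Beta function. -/
noncomputable def extBetaWeight (α β : ℂ) (t : ℝ) : ℂ :=
  (t : ℂ) ^ (α - 3 / 2) * ((1 - t : ℝ) : ℂ) ^ (β - 3 / 2)

theorem extBeta_eq (p : ℂ) (ν : ℝ) (α β : ℂ) :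
    extBeta p ν α β = (2 * p / (Real.pi : ℂ)) ^ (1 / 2 : ℂ) *
      ∫ t in Set.Ioo (0 : ℝ) 1, extBetaWeight α β t *
        besselK (ν + 1 / 2) (p / ((t * (1 - t) : ℝ) : ℂ)) := by
  rw [extBeta, intervalIntegral.integral_of_le zero_le_one, integral_Ioc_eq_integral_Ioo]
  rfl

theorem mul_one_sub_pos {t : ℝ} (ht : t ∈ Set.Ioo (0 : ℝ) 1) : 0 < t * (1 - t) :=
  mul_pos ht.1 (sub_pos.2 ht.2)

/-- The exponent c + 1/2 is the power of t(1-t) released by K_{ν+1/2}(p/(t(1-t))); it turns the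
exponents -3/2 into the c - 1 of a Beta integral. -/
theorem norm_extBetaWeight_mul (α β : ℂ) (c : ℝ) {t : ℝ} (ht : t ∈ Set.Ioo (0 : ℝ) 1) :
    ‖extBetaWeight α β t‖ * (t * (1 - t)) ^ (c + 1 / 2) =
      t ^ (α.re + c - 1) * (1 - t) ^ (β.re + c - 1) := by
  have h0 : 0 < t := ht.1
  have h1 : 0 < 1 - t := sub_pos.2 ht.2
  have h32 : (3 / 2 : ℂ).re = 3 / 2 := by norm_num
  rw [extBetaWeight, norm_cpow_mul_one_sub_cpow _ _ ht, Real.mul_rpow h0.le h1.le,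
    mul_mul_mul_comm, ← Real.rpow_add h0, ← Real.rpow_add h1, Complex.sub_re, Complex.sub_re, h32]
  congr 2 <;> ring

theorem extBetaWeight_mul_cpow (α β s : ℂ) {t : ℝ} (ht : t ∈ Set.Ioo (0 : ℝ) 1) :
    extBetaWeight α β t * ((t * (1 - t) : ℝ) : ℂ) ^ (s + 1 / 2) =
      (t : ℂ) ^ (α + s - 1) * (1 - (t : ℂ)) ^ (β + s - 1) := by
  have h0 : 0 < t := ht.1
  have h1 : 0 < 1 - t := sub_pos.2 ht.2
  have h0' : (t : ℂ) ≠ 0 := by exact_mod_cast h0.ne'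
  have h1' : ((1 - t : ℝ) : ℂ) ≠ 0 := by exact_mod_cast h1.ne'
  rw [extBetaWeight, Complex.ofReal_mul, Complex.mul_cpow_ofReal_nonneg h0.le h1.le,
    mul_mul_mul_comm, ← Complex.cpow_add _ _ h0', ← Complex.cpow_add _ _ h1',
    show (1 : ℂ) - t = ((1 - t : ℝ) : ℂ) by push_cast; rfl]
  congr 2 <;> ring

theorem re_div_mul_one_sub_pos {p : ℂ} (hp : 0 < p.re) {t : ℝ} (ht : t ∈ Set.Ioo (0 : ℝ) 1) :
    0 < (p / ((t * (1 - t) : ℝ) : ℂ)).re := by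
  rw [Complex.div_ofReal_re]
  exact div_pos hp (mul_one_sub_pos ht)

/-- The power bound for K_{ν+1/2} is used with M = c + 1/2, admissible because c > ν. The constant
depends on neither α, β nor p, which is what later allows summation over the series and passage to
limits in p. -/
theorem exists_norm_extBeta_integrand_le {ν c : ℝ} (hν : 0 ≤ ν) (hc : ν < c) :
    ∃ C, 0 ≤ C ∧ ∀ (a : ℝ) (p α β : ℂ) (t : ℝ), 0 < a → a ≤ p.re → t ∈ Set.Ioo (0 : ℝ) 1 →
      ‖extBetaWeight α β t * besselK (ν + 1 / 2) (p / ((t * (1 - t) : ℝ) : ℂ))‖ ≤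
        C * a ^ (-(c + 1 / 2)) * (t ^ (α.re + c - 1) * (1 - t) ^ (β.re + c - 1)) := by
  obtain ⟨C, hC, h⟩ := exists_norm_besselK_le (μ := ν + 1 / 2) (M := c + 1 / 2) (by linarith)
    (by linarith)
  refine ⟨C, hC, fun a p α β t ha hp ht => ?_⟩
  have hd := mul_one_sub_pos ht
  rw [norm_mul, ← norm_extBetaWeight_mul α β c ht]
  calc _ ≤ ‖extBetaWeight α β t‖ * (C * (a / (t * (1 - t))) ^ (-(c + 1 / 2))) := by
        gcongr
        refine (h _ (re_div_mul_one_sub_pos (ha.trans_le hp) ht)).trans ?_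
        refine mul_le_mul_of_nonneg_left ?_ hC
        rw [Complex.div_ofReal_re]
        exact Real.rpow_le_rpow_of_nonpos (by positivity) (by gcongr) (by linarith)
    _ = _ := by
        rw [Real.div_rpow ha.le hd.le, Real.rpow_neg hd.le, div_inv_eq_mul]
        ring

theorem continuousOn_extBeta_integrand {ν : ℝ} (hν : 0 ≤ ν) (α β : ℂ) {p : ℂ} (hp : 0 < p.re) :
    ContinuousOn (fun x : ℝ × ℝ => extBetaWeight α β x.2 *
      besselK (ν + 1 / 2) (p * x.1 / ((x.2 * (1 - x.2) : ℝ) : ℂ)))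
      (Set.Ioi 0 ×ˢ Set.Ioo 0 1) := by
  refine ContinuousOn.mul ?_ ?_
  · exact (continuousOn_cpow_mul_one_sub_cpow _ _).comp continuousOn_snd fun x hx => hx.2
  · refine (continuousOn_besselK (by linarith)).comp (ContinuousOn.div (by fun_prop) (by fun_prop)
      fun x hx => ?_) fun x hx => ?_
    · exact_mod_cast (mul_one_sub_pos hx.2).ne'
    · refine re_div_mul_one_sub_pos ?_ hx.2
      rw [Complex.re_mul_ofReal]
      exact mul_pos hp hx.1

theorem aestronglyMeasurable_extBeta_integrand {ν : ℝ} (hν : 0 ≤ ν) (α β : ℂ) {p : ℂ}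
    (hp : 0 < p.re) :
    AEStronglyMeasurable (fun t : ℝ => extBetaWeight α β t *
      besselK (ν + 1 / 2) (p / ((t * (1 - t) : ℝ) : ℂ))) (volume.restrict (Set.Ioo 0 1)) := by
  refine ContinuousOn.aestronglyMeasurable ?_ measurableSet_Ioo
  have h := (continuousOn_extBeta_integrand hν α β hp).comp
    (f := fun t : ℝ => ((1 : ℝ), t)) (s := Set.Ioo 0 1) (by fun_prop)
    fun t ht => ⟨Set.mem_Ioi.2 one_pos, ht⟩
  refine h.congr fun t ht => ?_
  simp

theorem exists_norm_extBeta_le {ν c : ℝ} (hν : 0 ≤ ν) (hc : ν < c) :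
    ∃ C, 0 ≤ C ∧ ∀ (a : ℝ) (p α β : ℂ), 0 < a → a ≤ p.re → 0 < α.re + c → 0 < β.re + c →
      ‖extBeta p ν α β‖ ≤ ‖(2 * p / (Real.pi : ℂ)) ^ (1 / 2 : ℂ)‖ * (C * a ^ (-(c + 1 / 2)) *
        ‖betaFn ((α.re + c : ℝ) : ℂ) ((β.re + c : ℝ) : ℂ)‖) := by
  obtain ⟨C, hC, h⟩ := exists_norm_extBeta_integrand_le hν hc
  refine ⟨C, hC, fun a p α β ha hp hα hβ => ?_⟩
  rw [extBeta_eq, norm_mul, ← integral_rpow_mul_one_sub_rpow hα hβ, ← integral_const_mul]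
  gcongr
  exact norm_integral_le_of_norm_le ((integrableOn_rpow_mul_one_sub_rpow hα hβ).const_mul _)
    ((ae_restrict_iff' measurableSet_Ioo).2 (.of_forall fun t ht => h a p α β t ha hp ht))

theorem continuousAt_extBeta {ν c : ℝ} (hν : 0 ≤ ν) (hc : ν < c) {α β p : ℂ} (hp : 0 < p.re)
    (hα : 0 < α.re + c) (hβ : 0 < β.re + c) :
    ContinuousAt (fun p => extBeta p ν α β) p := by
  obtain ⟨C, hC, h⟩ := exists_norm_extBeta_integrand_le hν hc
  simp only [extBeta_eq]
  have hopen : {r : ℂ | p.re / 2 < r.re} ∈ nhds p :=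
    (isOpen_lt continuous_const Complex.continuous_re).mem_nhds (by simpa using by linarith)
  refine ContinuousAt.mul ?_ (continuousAt_of_dominated
    (bound := fun t => C * (p.re / 2) ^ (-(c + 1 / 2)) *
      (t ^ (α.re + c - 1) * (1 - t) ^ (β.re + c - 1))) ?_ ?_ ?_ ?_)
  · refine ContinuousAt.cpow (by fun_prop) continuousAt_const (Or.inl ?_)
    rw [Complex.div_ofReal_re]
    exact div_pos (by simpa using hp) Real.pi_pos
  · filter_upwards [hopen] with q hq
    have hq' : p.re / 2 < q.re := hq
    exact aestronglyMeasurable_extBeta_integrand hν α β (by linarith)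
  · filter_upwards [hopen] with q hq
    have hq' : p.re / 2 < q.re := hq
    exact (ae_restrict_iff' measurableSet_Ioo).2 (.of_forall fun t ht =>
      h _ q α β t (by linarith) hq'.le ht)
  · exact (integrableOn_rpow_mul_one_sub_rpow hα hβ).const_mul _
  · refine (ae_restrict_iff' measurableSet_Ioo).2 (.of_forall fun t ht => ?_)
    have hK := (continuousOn_besselK (μ := ν + 1 / 2) (by linarith)).continuousAt
      ((isOpen_lt continuous_const Complex.continuous_re).mem_nhds
        (re_div_mul_one_sub_pos hp ht))
    exact continuousAt_const.mul (ContinuousAt.comp (f := fun p : ℂ =>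
      p / ((t * (1 - t) : ℝ) : ℂ)) hK (by fun_prop))

/-! ### Mellin transform of the extended Beta function -/

/-- The Mellin transform of `q ↦ K_μ(p q / (t (1 - t)))`. -/
theorem hasMellin_besselK_div {p σ : ℂ} {μ : ℝ} (hp : 0 < p.re) (hμ : 0 ≤ μ) (hσ : μ < σ.re)
    {d : ℝ} (hd : 0 < d) :
    HasMellin (fun q : ℝ => besselK μ (p * q / (d : ℂ))) σ ((d : ℂ) ^ σ * (p ^ (-σ) *
      (2 ^ (σ - 2) * (Complex.Gamma ((σ + μ) / 2) * Complex.Gamma ((σ - μ) / 2))))) := by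
  have h := hasMellin_besselK hp hμ hσ
  have hf : (fun q : ℝ => besselK μ (p * q / (d : ℂ))) =
      fun q : ℝ => (fun q : ℝ => besselK μ (p * q)) (d⁻¹ * q) := by
    funext q
    simp only
    congr 1
    push_cast
    ring
  rw [hf]
  refine ⟨(MellinConvergent.comp_mul_left (inv_pos.2 hd)).2 h.1, ?_⟩
  rw [mellin_comp_mul_left (fun q : ℝ => besselK μ (p * q)) _ (inv_pos.2 hd), h.2, smul_eq_mul, Complex.ofReal_inv,
    Complex.inv_cpow, Complex.cpow_neg, inv_inv]
  rw [Complex.arg_ofReal_of_nonneg hd.le]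
  exact Real.pi_pos.ne

theorem integral_norm_besselK_div {p : ℂ} {μ σ d : ℝ} (hd : 0 < d) :
    ∫ q in Set.Ioi (0 : ℝ), q ^ (σ - 1) * ‖besselK μ (p * q / (d : ℂ))‖ =
      d ^ σ * ∫ q in Set.Ioi (0 : ℝ), q ^ (σ - 1) * ‖besselK μ (p * q)‖ := by
  have h := integral_comp_mul_left_Ioi (fun q : ℝ => q ^ (σ - 1) * ‖besselK μ (p * q)‖) 0
    (inv_pos.2 hd)
  rw [mul_zero, inv_inv, smul_eq_mul] at h
  have h2 : d ^ σ = d ^ (σ - 1) * d := by rw [Real.rpow_sub_one hd.ne']; field_simp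
  rw [h2, mul_assoc, ← h, ← integral_const_mul]
  refine setIntegral_congr_fun measurableSet_Ioi fun q hq => ?_
  have hq' : 0 < q := hq
  have h3 : d ^ (σ - 1) * (d⁻¹ * q) ^ (σ - 1) = q ^ (σ - 1) := by
    rw [← Real.mul_rpow hd.le (by positivity), mul_inv_cancel_left₀ hd.ne']
  rw [← mul_assoc, h3, show p * ((d⁻¹ * q : ℝ) : ℂ) = p * q / d by push_cast; ring]

/-- The factor `p ^ (-s) 2 ^ (s - 1) π ^ (-1/2) Γ((s - ν)/2) Γ((s + ν + 1)/2)` of the Mellin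
transform of `q ↦ B_{pq,ν}`. -/
noncomputable def mellinFactor (p : ℂ) (ν : ℝ) (s : ℂ) : ℂ :=
  p ^ (-s) * (2 ^ (s - 1) * (Real.pi : ℂ) ^ (-(1 / 2) : ℂ) *
    (Complex.Gamma ((s - ν) / 2) * Complex.Gamma ((s + ν + 1) / 2)))

theorem two_mul_div_pi_cpow {p : ℂ} (hp : 0 < p.re) :
    (2 * p / (Real.pi : ℂ)) ^ (1 / 2 : ℂ) =
      2 ^ (1 / 2 : ℂ) * p ^ (1 / 2 : ℂ) * (Real.pi : ℂ) ^ (-(1 / 2) : ℂ) := by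
  have hp0 : p ≠ 0 := by rintro rfl; simp at hp
  have h : 2 * p / (Real.pi : ℂ) = p * ((2 * Real.pi⁻¹ : ℝ) : ℂ) := by
    push_cast; ring
  have hpi := Real.pi_pos
  rw [h, mul_ofReal_cpow hp0 (by positivity), Complex.ofReal_mul,
    Complex.mul_cpow_ofReal_nonneg two_pos.le (by positivity), Complex.ofReal_inv,
    Complex.inv_cpow, Complex.cpow_neg]
  · push_cast
    ring
  · rw [Complex.arg_ofReal_of_nonneg hpi.le]
    exact hpi.ne

theorem mellinFactor_eq {p : ℂ} (hp : 0 < p.re) (ν : ℝ) (s : ℂ) :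
    (2 * p / (Real.pi : ℂ)) ^ (1 / 2 : ℂ) * (p ^ (-(s + 1 / 2)) * (2 ^ (s + 1 / 2 - 2) *
      (Complex.Gamma ((s + 1 / 2 + ((ν + 1 / 2 : ℝ) : ℂ)) / 2) *
        Complex.Gamma ((s + 1 / 2 - ((ν + 1 / 2 : ℝ) : ℂ)) / 2)))) = mellinFactor p ν s := by
  have hp0 : p ≠ 0 := by rintro rfl; simp at hp
  rw [two_mul_div_pi_cpow hp, mellinFactor]
  have e1 : p ^ (-s) = p ^ (1 / 2 : ℂ) * p ^ (-(s + 1 / 2)) := by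
    rw [← Complex.cpow_add _ _ hp0]; congr 1; ring
  have e2 : (2 : ℂ) ^ (s - 1) = 2 ^ (1 / 2 : ℂ) * 2 ^ (s + 1 / 2 - 2) := by
    rw [← Complex.cpow_add _ _ two_ne_zero]; congr 1; ring
  have e3 : (s + 1 / 2 + ((ν + 1 / 2 : ℝ) : ℂ)) / 2 = (s + ν + 1) / 2 := by push_cast; ring
  have e4 : (s + 1 / 2 - ((ν + 1 / 2 : ℝ) : ℂ)) / 2 = (s - ν) / 2 := by push_cast; ring
  rw [e1, e2, e3, e4]
  ring

theorem norm_extBeta_mellin_kernel {s : ℂ} (p α β : ℂ) (ν : ℝ) {t q : ℝ}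
    (hq : q ∈ Set.Ioi (0 : ℝ)) :
    ‖(q : ℂ) ^ (s + 1 / 2 - 1) * (extBetaWeight α β t *
        besselK (ν + 1 / 2) (p * q / ((t * (1 - t) : ℝ) : ℂ)))‖ =
      ‖extBetaWeight α β t‖ * (q ^ (s.re + 1 / 2 - 1) *
        ‖besselK (ν + 1 / 2) (p * q / ((t * (1 - t) : ℝ) : ℂ))‖) := by
  have h12 : (1 / 2 : ℂ).re = 1 / 2 := by norm_num
  rw [norm_mul, norm_mul, Complex.norm_cpow_eq_rpow_re_of_pos hq, Complex.sub_re, Complex.add_re,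
    h12, Complex.one_re]
  ring

theorem integral_norm_extBeta_mellin_kernel {s : ℂ} (p α β : ℂ) (ν : ℝ) {t : ℝ}
    (ht : t ∈ Set.Ioo (0 : ℝ) 1) :
    ∫ q in Set.Ioi (0 : ℝ), ‖(q : ℂ) ^ (s + 1 / 2 - 1) * (extBetaWeight α β t *
        besselK (ν + 1 / 2) (p * q / ((t * (1 - t) : ℝ) : ℂ)))‖ =
      (∫ q in Set.Ioi (0 : ℝ), q ^ (s.re + 1 / 2 - 1) * ‖besselK (ν + 1 / 2) (p * q)‖) *
        (t ^ (α.re + s.re - 1) * (1 - t) ^ (β.re + s.re - 1)) := by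
  rw [setIntegral_congr_fun measurableSet_Ioi fun q hq =>
    norm_extBeta_mellin_kernel (s := s) p α β ν (t := t) hq, integral_const_mul,
    integral_norm_besselK_div (mul_one_sub_pos ht), ← norm_extBetaWeight_mul _ _ _ ht]
  ring

theorem integrable_extBeta_mellin_kernel {p s α β : ℂ} {ν : ℝ} (hp : 0 < p.re) (hν : 0 ≤ ν)
    (hs : ν < s.re) (hα : 0 < α.re + s.re) (hβ : 0 < β.re + s.re) :
    Integrable (Function.uncurry fun q t : ℝ => (q : ℂ) ^ (s + 1 / 2 - 1) *
      (extBetaWeight α β t * besselK (ν + 1 / 2) (p * q / ((t * (1 - t) : ℝ) : ℂ))))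
      ((volume.restrict (Set.Ioi (0 : ℝ))).prod (volume.restrict (Set.Ioo (0 : ℝ) 1))) := by
  have hre : ν + 1 / 2 < (s + 1 / 2).re := by
    rw [Complex.add_re, show (1 / 2 : ℂ).re = 1 / 2 by norm_num]; linarith
  refine (integrable_prod_iff' ?_).2 ⟨?_, ?_⟩
  · rw [Measure.prod_restrict]
    refine ContinuousOn.aestronglyMeasurable (ContinuousOn.mul ?_ ?_)
      (measurableSet_Ioi.prod measurableSet_Ioo)
    · exact (continuousOn_ofReal_cpow _).comp continuousOn_fst fun x hx => hx.1
    · exact continuousOn_extBeta_integrand hν α β hp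
  · refine (ae_restrict_iff' measurableSet_Ioo).2 (.of_forall fun t ht => ?_)
    refine ((hasMellin_besselK_div hp (by linarith) hre (mul_one_sub_pos ht)).1.const_mul
      (extBetaWeight α β t)).congr (.of_forall fun q => ?_)
    simp only [Function.uncurry_apply_pair, smul_eq_mul]
    ring
  · refine ((integrableOn_rpow_mul_one_sub_rpow hα hβ).const_mul (∫ q in Set.Ioi (0 : ℝ),
      q ^ (s.re + 1 / 2 - 1) * ‖besselK (ν + 1 / 2) (p * q)‖)).congr
      ((ae_restrict_iff' measurableSet_Ioo).2 (.of_forall fun t ht => ?_))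
    exact (integral_norm_extBeta_mellin_kernel p α β ν ht).symm

/-- The prefactor √(2pq/π) contributes q^{1/2}, so the Mellin variable for the Bessel function is s
+ 1/2. This matches the order ν + 1/2 and makes Re s > ν the exact requirement. -/
theorem cpow_smul_extBeta {p s : ℂ} (hp : 0 < p.re) (α β : ℂ) (ν : ℝ) {q : ℝ} (hq : 0 < q) :
    (q : ℂ) ^ (s - 1) • extBeta (p * q) ν α β =
      (2 * p / (Real.pi : ℂ)) ^ (1 / 2 : ℂ) * ∫ t in Set.Ioo (0 : ℝ) 1,
        (q : ℂ) ^ (s + 1 / 2 - 1) * (extBetaWeight α β t *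
          besselK (ν + 1 / 2) (p * q / ((t * (1 - t) : ℝ) : ℂ))) := by
  have hq0 : (q : ℂ) ≠ 0 := by exact_mod_cast hq.ne'
  have hp0 : 2 * p / (Real.pi : ℂ) ≠ 0 := by
    have : p ≠ 0 := by rintro rfl; simp at hp
    have := Real.pi_pos.ne'
    simp_all
  rw [integral_const_mul, extBeta_eq, smul_eq_mul,
    show 2 * (p * q) / (Real.pi : ℂ) = 2 * p / (Real.pi : ℂ) * q by ring,
    mul_ofReal_cpow hp0 hq, show s + 1 / 2 - 1 = (s - 1) + 1 / 2 by ring,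
    Complex.cpow_add _ _ hq0]
  ring

/-- The Mellin transform of `q ↦ B_{pq,ν}(α, β)`. -/
theorem hasMellin_extBeta {p s α β : ℂ} {ν : ℝ} (hp : 0 < p.re) (hν : 0 ≤ ν)
    (hs : ν < s.re) (hα : 0 < α.re + s.re) (hβ : 0 < β.re + s.re) :
    HasMellin (fun q : ℝ => extBeta (p * q) ν α β) s
      (mellinFactor p ν s * betaFn (α + s) (β + s)) := by
  have hre : ν + 1 / 2 < (s + 1 / 2).re := by
    rw [Complex.add_re, show (1 / 2 : ℂ).re = 1 / 2 by norm_num]; linarith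
  have hint := integrable_extBeta_mellin_kernel hp hν hs hα hβ
  constructor
  · refine (hint.integral_prod_left.const_mul ((2 * p / (Real.pi : ℂ)) ^ (1 / 2 : ℂ))).congr
      ((ae_restrict_iff' measurableSet_Ioi).2 (.of_forall fun q hq => ?_))
    exact (cpow_smul_extBeta hp α β ν hq).symm
  · rw [mellin, setIntegral_congr_fun measurableSet_Ioi fun q hq =>
      cpow_smul_extBeta (s := s) hp α β ν hq, integral_const_mul, integral_integral_swap hint]
    have hin (t : ℝ) (ht : t ∈ Set.Ioo (0 : ℝ) 1) :
        (∫ q in Set.Ioi (0 : ℝ), (q : ℂ) ^ (s + 1 / 2 - 1) * (extBetaWeight α β t *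
          besselK (ν + 1 / 2) (p * q / ((t * (1 - t) : ℝ) : ℂ)))) =
        (t : ℂ) ^ (α + s - 1) * (1 - (t : ℂ)) ^ (β + s - 1) *
          (p ^ (-(s + 1 / 2)) * (2 ^ (s + 1 / 2 - 2) *
          (Complex.Gamma ((s + 1 / 2 + ((ν + 1 / 2 : ℝ) : ℂ)) / 2) *
          Complex.Gamma ((s + 1 / 2 - ((ν + 1 / 2 : ℝ) : ℂ)) / 2)))) := by
      have h := (hasMellin_besselK_div hp (by linarith) hre (mul_one_sub_pos ht)).2
      rw [mellin] at h
      simp only [smul_eq_mul] at h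
      simp only [mul_left_comm _ (extBetaWeight α β t)]
      rw [integral_const_mul, h, ← mul_assoc, extBetaWeight_mul_cpow α β s ht]
    have hα' : 0 < (α + s).re := by rwa [Complex.add_re]
    have hβ' : 0 < (β + s).re := by rwa [Complex.add_re]
    rw [setIntegral_congr_fun measurableSet_Ioo hin, integral_mul_const,
      betaFn_eq_betaIntegral hα' hβ', Complex.betaIntegral,
      intervalIntegral.integral_of_le zero_le_one, integral_Ioc_eq_integral_Ioo,
      ← mellinFactor_eq hp]
    ring

/-- By scaling, the inner absolute q-integral is a fixed constant times a power of t(1-t). That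
constant does not involve α or β, so the bound can be summed over the series. -/
theorem exists_integral_norm_extBeta_le {p : ℂ} {ν : ℝ} (s : ℂ) (hp : 0 < p.re) (hν : 0 ≤ ν)
    (hs : ν < s.re) :
    ∃ A, ∀ α β : ℂ, 0 < α.re + s.re → 0 < β.re + s.re →
      ∫ q in Set.Ioi (0 : ℝ), ‖(q : ℂ) ^ (s - 1) • extBeta (p * q) ν α β‖ ≤
        A * ‖betaFn ((α.re + s.re : ℝ) : ℂ) ((β.re + s.re : ℝ) : ℂ)‖ := by
  refine ⟨‖(2 * p / (Real.pi : ℂ)) ^ (1 / 2 : ℂ)‖ * ∫ q in Set.Ioi (0 : ℝ),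
    q ^ (s.re + 1 / 2 - 1) * ‖besselK (ν + 1 / 2) (p * q)‖, fun α β hα hβ => ?_⟩
  have hint := integrable_extBeta_mellin_kernel hp hν hs hα hβ
  have hle : ∫ q in Set.Ioi (0 : ℝ), ‖(q : ℂ) ^ (s - 1) • extBeta (p * q) ν α β‖ ≤
      ∫ q in Set.Ioi (0 : ℝ), ‖(2 * p / (Real.pi : ℂ)) ^ (1 / 2 : ℂ)‖ *
        ∫ t in Set.Ioo (0 : ℝ) 1, ‖(q : ℂ) ^ (s + 1 / 2 - 1) * (extBetaWeight α β t *
          besselK (ν + 1 / 2) (p * q / ((t * (1 - t) : ℝ) : ℂ)))‖ := by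
    refine setIntegral_mono_on (hasMellin_extBeta hp hν hs hα hβ).1.norm
      (hint.norm.integral_prod_left.const_mul _) measurableSet_Ioi fun q hq => ?_
    rw [cpow_smul_extBeta hp α β ν hq, norm_mul]
    gcongr
    exact norm_integral_le_integral_norm _
  refine hle.trans (le_of_eq ?_)
  rw [integral_const_mul, integral_integral_swap hint.norm,
    setIntegral_congr_fun measurableSet_Ioo fun t ht =>
      integral_norm_extBeta_mellin_kernel (s := s) p α β ν ht, integral_const_mul,
    integral_rpow_mul_one_sub_rpow hα hβ, mul_assoc]

/-! ### Integrability on vertical lines -/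

theorem integrable_exp_neg_mul_abs {δ : ℝ} (hδ : 0 < δ) :
    Integrable fun τ : ℝ => Real.exp (-(δ * |τ|)) := by
  refine (integrable_inv_one_add_sq.const_mul (1 + 2 / δ ^ 2)).mono'
    (Continuous.aestronglyMeasurable (by fun_prop)) (.of_forall fun τ => ?_)
  rw [Real.norm_of_nonneg (Real.exp_pos _).le, Real.exp_neg, ← div_eq_mul_inv,
    le_div_iff₀ (by positivity), inv_mul_le_iff₀ (Real.exp_pos _)]
  have h := Real.quadratic_le_exp_of_nonneg (x := δ * |τ|) (by positivity)
  have h1 : 1 + τ ^ 2 ≤ (1 + (δ * |τ|) ^ 2 / 2) * (1 + 2 / δ ^ 2) := by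
    rw [mul_pow, sq_abs]
    have : (1 + δ ^ 2 * τ ^ 2 / 2) * (1 + 2 / δ ^ 2) =
        1 + τ ^ 2 + (δ ^ 2 * τ ^ 2 / 2 + 2 / δ ^ 2) := by
      field_simp; ring
    rw [this]
    have : 0 ≤ δ ^ 2 * τ ^ 2 / 2 + 2 / δ ^ 2 := by positivity
    linarith
  refine h1.trans ?_
  gcongr
  have : 0 ≤ δ * |τ| := by positivity
  linarith

theorem integrable_tsum_of_summable_integral_norm {X ι : Type*} [MeasurableSpace X] [Countable ι]
    {m : Measure X} {F : ι → X → ℂ} (hF : ∀ i, Integrable (F i) m)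
    (hsum : Summable fun i => ∫ x, ‖F i x‖ ∂m) (hpt : ∀ᵐ x ∂m, Summable fun i => F i x)
    (hmeas : AEStronglyMeasurable (fun x => ∑' i, F i x) m) :
    Integrable (fun x => ∑' i, F i x) m := by
  refine ⟨hmeas, ?_⟩
  rw [hasFiniteIntegral_iff_enorm]
  calc ∫⁻ x, ‖∑' i, F i x‖ₑ ∂m ≤ ∫⁻ x, ∑' i, ‖F i x‖ₑ ∂m := by
        refine lintegral_mono_ae (hpt.mono fun x hx => ?_)
        simp only [← ofReal_norm]
        rw [← ENNReal.ofReal_tsum_of_nonneg (fun i => norm_nonneg _) hx.norm]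
        exact ENNReal.ofReal_le_ofReal (norm_tsum_le_tsum_norm hx.norm)
    _ = ∑' i, ENNReal.ofReal (∫ x, ‖F i x‖ ∂m) := by
        rw [lintegral_tsum fun i => (hF i).aestronglyMeasurable.enorm]
        simp only [ofReal_integral_norm_eq_lintegral_enorm (hF _)]
    _ < ⊤ := by
        rw [← ENNReal.ofReal_tsum_of_nonneg (fun i => by positivity) hsum]
        exact ENNReal.ofReal_lt_top

theorem linePt_re (c τ : ℝ) : (linePt c τ).re = c := by simp [linePt]

theorem linePt_im (c τ : ℝ) : (linePt c τ).im = τ := by simp [linePt]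

theorem continuous_linePt (c : ℝ) : Continuous (linePt c) := by
  unfold linePt
  fun_prop

theorem continuousAt_Gamma {s : ℂ} (hs : 0 < s.re) : ContinuousAt Complex.Gamma s :=
  (Complex.differentiableAt_Gamma s (NotNonposInt.of_re_pos hs)).continuousAt

theorem continuous_betaFn_linePt {α β : ℂ} {c : ℝ} (hα : 0 < α.re + c) (hβ : 0 < β.re + c) :
    Continuous fun τ : ℝ => betaFn (α + linePt c τ) (β + linePt c τ) := by
  have hl := continuous_linePt c
  rw [continuous_iff_continuousAt]
  intro τ
  have h1 : 0 < (α + linePt c τ).re := by rwa [Complex.add_re, linePt_re]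
  have h2 : 0 < (β + linePt c τ).re := by rwa [Complex.add_re, linePt_re]
  have h3 : 0 < (α + linePt c τ + (β + linePt c τ)).re := by
    rw [Complex.add_re]; linarith
  simp only [betaFn]
  refine ContinuousAt.div (ContinuousAt.mul ?_ ?_) ?_ (Complex.Gamma_ne_zero_of_re_pos h3)
  · exact ContinuousAt.comp (f := fun τ => α + linePt c τ) (continuousAt_Gamma h1) (by fun_prop)
  · exact ContinuousAt.comp (f := fun τ => β + linePt c τ) (continuousAt_Gamma h2) (by fun_prop)
  · exact ContinuousAt.comp (f := fun τ => α + linePt c τ + (β + linePt c τ))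
      (continuousAt_Gamma h3) (by fun_prop)

theorem re_gamma_args {ν : ℝ} {s : ℂ} (hν : 0 ≤ ν) (hs : ν < s.re) :
    0 < ((s - ν) / 2).re ∧ 0 < ((s + ν + 1) / 2).re := by
  rw [Complex.div_ofNat_re, Complex.div_ofNat_re, Complex.sub_re, Complex.add_re, Complex.add_re,
    Complex.ofReal_re, Complex.one_re]
  constructor <;> linarith

theorem continuous_mellinFactor_linePt {p : ℂ} (hp : p ≠ 0) {ν c : ℝ} (hν : 0 ≤ ν) (hc : ν < c) :
    Continuous fun τ : ℝ => mellinFactor p ν (linePt c τ) := by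
  have hl := continuous_linePt c
  rw [continuous_iff_continuousAt]
  intro τ
  obtain ⟨h1, h2⟩ := re_gamma_args (s := linePt c τ) hν (by rwa [linePt_re])
  unfold mellinFactor
  refine ContinuousAt.mul ?_ (ContinuousAt.mul (ContinuousAt.mul ?_ continuousAt_const)
    (ContinuousAt.mul ?_ ?_))
  · exact (Continuous.const_cpow (by fun_prop) (Or.inl hp)).continuousAt
  · exact (Continuous.const_cpow (by fun_prop) (Or.inl two_ne_zero)).continuousAt
  · exact ContinuousAt.comp (f := fun τ => (linePt c τ - ν) / 2) (continuousAt_Gamma h1)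
      (by fun_prop)
  · exact ContinuousAt.comp (f := fun τ => (linePt c τ + ν + 1) / 2) (continuousAt_Gamma h2)
      (by fun_prop)

theorem exists_norm_mellinFactor_le {p : ℂ} (hp : 0 < p.re) {ν c : ℝ} (hν : 0 ≤ ν) (hc : ν < c) :
    ∃ δ K, 0 < δ ∧ 0 ≤ K ∧
      ∀ τ : ℝ, ‖mellinFactor p ν (linePt c τ)‖ ≤ K * Real.exp (-(δ * |τ|)) := by
  have hp0 : p ≠ 0 := by rintro rfl; simp at hp
  -- Re p > 0 means |arg p| < π/2. Each Gamma argument has imaginary part τ/2, so the two together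
  -- give e^{-θ|τ|}, against e^{|arg p||τ|} from p^{-s}; the net rate is δ = θ - |arg p| > 0.
  obtain ⟨θ, hθ1, hθ2⟩ := exists_between (Complex.abs_arg_lt_pi_div_two_iff.2 (Or.inl hp))
  have hθ0 : 0 ≤ θ := (abs_nonneg _).trans hθ1.le
  have hcos : 0 < Real.cos θ := Real.cos_pos_of_mem_Ioo ⟨by linarith [Real.pi_pos], hθ2⟩
  set g : ℝ → ℝ := fun x => (1 / Real.cos θ) ^ x * Real.Gamma x with hg
  have hgam : 0 < (c - ν) / 2 ∧ 0 < (c + ν + 1) / 2 := by constructor <;> linarith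
  have hg1 : 0 ≤ g ((c - ν) / 2) := mul_nonneg (by positivity) (Real.Gamma_pos_of_pos hgam.1).le
  have hg2 : 0 ≤ g ((c + ν + 1) / 2) := mul_nonneg (by positivity) (Real.Gamma_pos_of_pos hgam.2).le
  refine ⟨θ - |p.arg|, ‖p‖ ^ (-c) * ((2 : ℝ) ^ (c - 1) * ‖(Real.pi : ℂ) ^ (-(1 / 2) : ℂ)‖ *
    (g ((c - ν) / 2) * g ((c + ν + 1) / 2))), by linarith, by positivity, fun τ => ?_⟩
  obtain ⟨h1, h2⟩ := re_gamma_args (s := linePt c τ) hν (by rwa [linePt_re])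
  have k1 := norm_Gamma_le_exp h1 hθ0 hθ2
  have k2 := norm_Gamma_le_exp h2 hθ0 hθ2
  have r1 : ((linePt c τ - ν) / 2).re = (c - ν) / 2 := by
    rw [Complex.div_ofNat_re, Complex.sub_re, linePt_re, Complex.ofReal_re]
  have r2 : ((linePt c τ + ν + 1) / 2).re = (c + ν + 1) / 2 := by
    rw [Complex.div_ofNat_re, Complex.add_re, Complex.add_re, linePt_re, Complex.ofReal_re,
      Complex.one_re]
  have i1 : ((linePt c τ - ν) / 2).im = τ / 2 := by
    rw [Complex.div_ofNat_im, Complex.sub_im, linePt_im, Complex.ofReal_im, sub_zero]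
  have i2 : ((linePt c τ + ν + 1) / 2).im = τ / 2 := by
    rw [Complex.div_ofNat_im, Complex.add_im, Complex.add_im, linePt_im, Complex.ofReal_im,
      Complex.one_im, add_zero, add_zero]
  rw [r1, i1, abs_div, abs_two] at k1
  rw [r2, i2, abs_div, abs_two] at k2
  have k3 : ‖p ^ (-linePt c τ)‖ ≤ ‖p‖ ^ (-c) * Real.exp (|p.arg| * |τ|) := by
    rw [Complex.norm_cpow_of_ne_zero hp0, Complex.neg_re, Complex.neg_im, linePt_re, linePt_im,
      mul_neg, Real.exp_neg, div_inv_eq_mul]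
    refine mul_le_mul_of_nonneg_left (Real.exp_le_exp.2 ?_) (by positivity)
    rw [← abs_mul]
    exact le_abs_self _
  have k4 : ‖(2 : ℂ) ^ (linePt c τ - 1)‖ = (2 : ℝ) ^ (c - 1) := by
    have := Complex.norm_cpow_eq_rpow_re_of_pos two_pos (linePt c τ - 1)
    rwa [Complex.sub_re, linePt_re, Complex.one_re] at this
  rw [mellinFactor, norm_mul, norm_mul, norm_mul, norm_mul, k4]
  calc _ ≤ ‖p‖ ^ (-c) * Real.exp (|p.arg| * |τ|) * ((2 : ℝ) ^ (c - 1) *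
        ‖(Real.pi : ℂ) ^ (-(1 / 2) : ℂ)‖ * ((g ((c - ν) / 2) * Real.exp (-(θ * (|τ| / 2)))) *
          (g ((c + ν + 1) / 2) * Real.exp (-(θ * (|τ| / 2)))))) := by gcongr
    _ = ‖p‖ ^ (-c) * ((2 : ℝ) ^ (c - 1) * ‖(Real.pi : ℂ) ^ (-(1 / 2) : ℂ)‖ *
        (g ((c - ν) / 2) * g ((c + ν + 1) / 2))) * (Real.exp (|p.arg| * |τ|) *
          (Real.exp (-(θ * (|τ| / 2))) * Real.exp (-(θ * (|τ| / 2))))) := by ring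
    _ = _ := by
        rw [← Real.exp_add, ← Real.exp_add]
        congr 2
        ring

theorem mellinFactor_eq_cpow_mul_one (p : ℂ) (ν : ℝ) (s : ℂ) :
    mellinFactor p ν s = p ^ (-s) * mellinFactor 1 ν s := by
  rw [mellinFactor, mellinFactor, Complex.one_cpow, one_mul]

theorem two_div_cpow_mul_Gamma {p : ℂ} (hp : 0 < p.re) (ν : ℝ) (s : ℂ) :
    (2 / p) ^ s * Complex.Gamma ((s - ν) / 2) * Complex.Gamma ((s + ν + 1) / 2) =
      2 * (Real.pi : ℂ) ^ (1 / 2 : ℂ) * mellinFactor p ν s := by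
  have hp0 : p ≠ 0 := by rintro rfl; simp at hp
  have harg : p.arg ≠ Real.pi := by
    have := (abs_lt.1 (Complex.abs_arg_lt_pi_div_two_iff.2 (Or.inl hp))).2
    linarith [Real.pi_pos]
  have hpi : (Real.pi : ℂ) ≠ 0 := by exact_mod_cast Real.pi_pos.ne'
  have e1 : (2 / p) ^ s = 2 ^ s * p ^ (-s) := by
    rw [div_eq_mul_inv, mul_comm, show (2 : ℂ) = ((2 : ℝ) : ℂ) by norm_num,
      mul_ofReal_cpow (inv_ne_zero hp0) two_pos, Complex.inv_cpow _ _ harg, Complex.cpow_neg,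
      mul_comm]
  have e2 : (2 : ℂ) ^ s = 2 * 2 ^ (s - 1) := by
    rw [Complex.cpow_sub _ _ two_ne_zero, Complex.cpow_one]
    field_simp
  have e3 : (Real.pi : ℂ) ^ (1 / 2 : ℂ) * (Real.pi : ℂ) ^ (-(1 / 2) : ℂ) = 1 := by
    rw [← Complex.cpow_add _ _ hpi, add_neg_cancel, Complex.cpow_zero]
  rw [e1, e2, mellinFactor]
  linear_combination (-(2 * 2 ^ (s - 1) * p ^ (-s) * Complex.Gamma ((s - ν) / 2) *
    Complex.Gamma ((s + ν + 1) / 2))) * e3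

/-! ### Domination, continuity and Mellin transform of the series -/

section Series

variable (b₁ b₂ b₃ : ℂ) {c₁ c₂ c₃ x y z : ℂ}

theorem summable_termHBa (hc₁ : NotNonposInt c₁) (hc₂ : NotNonposInt c₂) (hc₃ : NotNonposInt c₃)
    (hxyz : InRegion x y z) {s : ℂ} (h₁ : 0 < b₁.re + s.re) (h₂ : 0 < b₂.re + s.re) :
    Summable (termHBa s b₁ b₂ b₃ c₁ c₂ c₃ x y z) := by
  refine ((summable_coeff_mul_betaFn b₁ b₂ b₃ hc₁ hc₂ hc₃ hxyz (β₁ := b₁ + s) (β₂ := b₂ + s)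
    (by simpa using h₁) (by simpa using h₂)).div_const (betaFn b₁ b₂)).congr fun i => ?_
  rw [termHBa, mul_div_assoc]

theorem re_shift_pos {b : ℂ} {c : ℝ} (h : 0 < b.re + c) (m n : ℕ) :
    0 < (b + m + n : ℂ).re + c := by
  have hm : (0 : ℝ) ≤ m := m.cast_nonneg
  have hn : (0 : ℝ) ≤ n := n.cast_nonneg
  simp only [Complex.add_re, Complex.natCast_re]
  linarith

variable (c₁ c₂ c₃ x y z) in
/-- The common majorant of the terms of both series, up to a constant. -/
noncomputable def majorant (c : ℝ) (i : ℕ × ℕ × ℕ) : ℝ :=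
  ‖coeff b₁ b₂ b₃ c₁ c₂ c₃ x y z i.1 i.2.1 i.2.2‖ *
    (‖betaFn (((b₁ + i.1 + i.2.2 : ℂ).re + c : ℝ) : ℂ) (((b₂ + i.1 + i.2.1 : ℂ).re + c : ℝ) : ℂ)‖ /
      ‖betaFn b₁ b₂‖)

theorem summable_majorant (hc₁ : NotNonposInt c₁) (hc₂ : NotNonposInt c₂) (hc₃ : NotNonposInt c₃)
    (hxyz : InRegion x y z) {c : ℝ} (h₁ : 0 < b₁.re + c) (h₂ : 0 < b₂.re + c) :
    Summable (majorant b₁ b₂ b₃ c₁ c₂ c₃ x y z c) := by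
  refine ((summable_coeff_mul_betaFn b₁ b₂ b₃ hc₁ hc₂ hc₃ hxyz (β₁ := ((b₁.re + c : ℝ) : ℂ))
    (β₂ := ((b₂.re + c : ℝ) : ℂ)) h₁ h₂).norm.div_const ‖betaFn b₁ b₂‖).congr fun i => ?_
  rw [majorant, norm_mul, mul_div_assoc]
  congr 4 <;>
  · simp only [Complex.add_re, Complex.natCast_re]
    push_cast
    ring

theorem norm_termHBa_le {s : ℂ} (h₁ : 0 < b₁.re + s.re) (h₂ : 0 < b₂.re + s.re)
    (i : ℕ × ℕ × ℕ) :
    ‖termHBa s b₁ b₂ b₃ c₁ c₂ c₃ x y z i‖ ≤ majorant b₁ b₂ b₃ c₁ c₂ c₃ x y z s.re i := by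
  have e₁ : b₁ + s + i.1 + i.2.2 = b₁ + i.1 + i.2.2 + s := by ring
  have e₂ : b₂ + s + i.1 + i.2.1 = b₂ + i.1 + i.2.1 + s := by ring
  rw [termHBa, majorant, norm_mul, norm_div, e₁, e₂]
  have := norm_betaFn_le (α := b₁ + i.1 + i.2.2 + s) (β := b₂ + i.1 + i.2.1 + s)
    (re_shift_pos h₁ _ _) (re_shift_pos h₂ _ _)
  gcongr
  exact this

theorem exists_norm_termHB_le {ν c : ℝ} (hν : 0 ≤ ν) (hc : ν < c) (h₁ : 0 < b₁.re + c)
    (h₂ : 0 < b₂.re + c) :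
    ∃ C, 0 ≤ C ∧ ∀ (a : ℝ) (p : ℂ) (i : ℕ × ℕ × ℕ), 0 < a → a ≤ p.re →
      ‖termHB p ν b₁ b₂ b₃ c₁ c₂ c₃ x y z i‖ ≤ ‖(2 * p / (Real.pi : ℂ)) ^ (1 / 2 : ℂ)‖ *
        (C * a ^ (-(c + 1 / 2))) * majorant b₁ b₂ b₃ c₁ c₂ c₃ x y z c i := by
  obtain ⟨C, hC, h⟩ := exists_norm_extBeta_le hν hc
  refine ⟨C, hC, fun a p i ha hp => ?_⟩
  rw [termHB, majorant, norm_mul, norm_div]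
  refine (mul_le_mul_of_nonneg_left (div_le_div_of_nonneg_right
    (h a p _ _ ha hp (re_shift_pos h₁ _ _) (re_shift_pos h₂ _ _)) (norm_nonneg _))
    (norm_nonneg _)).trans_eq ?_
  ring

theorem summable_termHB (hc₁ : NotNonposInt c₁) (hc₂ : NotNonposInt c₂) (hc₃ : NotNonposInt c₃)
    (hxyz : InRegion x y z) {ν c : ℝ} (hν : 0 ≤ ν) (hc : ν < c) (h₁ : 0 < b₁.re + c)
    (h₂ : 0 < b₂.re + c) {p : ℂ} (hp : 0 < p.re) :
    Summable (termHB p ν b₁ b₂ b₃ c₁ c₂ c₃ x y z) := by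
  obtain ⟨C, hC, h⟩ := exists_norm_termHB_le b₁ b₂ b₃ (c₁ := c₁) (c₂ := c₂) (c₃ := c₃) (x := x)
    (y := y) (z := z) hν hc h₁ h₂
  exact .of_norm_bounded ((summable_majorant b₁ b₂ b₃ hc₁ hc₂ hc₃ hxyz h₁ h₂).mul_left _)
    fun i => h p.re p i hp le_rfl

theorem continuousAt_HB (hc₁ : NotNonposInt c₁) (hc₂ : NotNonposInt c₂) (hc₃ : NotNonposInt c₃)
    (hxyz : InRegion x y z) {ν c : ℝ} (hν : 0 ≤ ν) (hc : ν < c) (h₁ : 0 < b₁.re + c)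
    (h₂ : 0 < b₂.re + c) {p : ℂ} (hp : 0 < p.re) :
    ContinuousAt (fun p => HB p ν b₁ b₂ b₃ c₁ c₂ c₃ x y z) p := by
  obtain ⟨C, hC, h⟩ := exists_norm_termHB_le b₁ b₂ b₃ (c₁ := c₁) (c₂ := c₂) (c₃ := c₃) (x := x)
    (y := y) (z := z) hν hc h₁ h₂
  have hopen : {r : ℂ | p.re / 2 < r.re} ∈ nhds p :=
    (isOpen_lt continuous_const Complex.continuous_re).mem_nhds (by simpa using by linarith)
  have hpre : ContinuousAt (fun p : ℂ => ‖(2 * p / (Real.pi : ℂ)) ^ (1 / 2 : ℂ)‖) p := by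
    refine (ContinuousAt.cpow (by fun_prop) continuousAt_const (Or.inl ?_)).norm
    rw [Complex.div_ofReal_re]
    exact div_pos (by simpa using hp) Real.pi_pos
  -- On this neighbourhood both p-dependent factors of the term bound are controlled: Re q stays
  -- above Re p / 2 and the square-root prefactor stays below its value at p plus 1. A uniform
  -- M-test then applies.
  have hN := Filter.inter_mem hopen (hpre.eventually_lt_const (lt_add_one _))
  refine ContinuousOn.continuousAt (continuousOn_tsum (u := fun i =>
    (‖(2 * p / (Real.pi : ℂ)) ^ (1 / 2 : ℂ)‖ + 1) * (C * (p.re / 2) ^ (-(c + 1 / 2))) *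
      majorant b₁ b₂ b₃ c₁ c₂ c₃ x y z c i) ?_ ?_ ?_) hN
  · intro i q hq
    have hq' : p.re / 2 < q.re := hq.1
    refine (ContinuousAt.mul continuousAt_const (ContinuousAt.div_const ?_ _)).continuousWithinAt
    exact continuousAt_extBeta hν hc (by linarith) (re_shift_pos h₁ _ _) (re_shift_pos h₂ _ _)
  · exact (summable_majorant b₁ b₂ b₃ hc₁ hc₂ hc₃ hxyz h₁ h₂).mul_left _
  · intro i q hq
    refine (h (p.re / 2) q i (by linarith) (le_of_lt hq.1)).trans ?_
    have hle : ‖(2 * q / (Real.pi : ℂ)) ^ (1 / 2 : ℂ)‖ ≤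
        ‖(2 * p / (Real.pi : ℂ)) ^ (1 / 2 : ℂ)‖ + 1 := by
      have hlt : ‖(2 * q / (Real.pi : ℂ)) ^ (1 / 2 : ℂ)‖ <
          ‖(2 * p / (Real.pi : ℂ)) ^ (1 / 2 : ℂ)‖ + 1 := hq.2
      exact hlt.le
    have hm : 0 ≤ majorant b₁ b₂ b₃ c₁ c₂ c₃ x y z c i := by unfold majorant; positivity
    gcongr

theorem continuous_HBa_linePt (hc₁ : NotNonposInt c₁) (hc₂ : NotNonposInt c₂)
    (hc₃ : NotNonposInt c₃) (hxyz : InRegion x y z) {c : ℝ} (h₁ : 0 < b₁.re + c)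
    (h₂ : 0 < b₂.re + c) :
    Continuous fun τ : ℝ => HBa (linePt c τ) b₁ b₂ b₃ c₁ c₂ c₃ x y z := by
  refine continuous_tsum (fun i => ?_) (summable_majorant b₁ b₂ b₃ hc₁ hc₂ hc₃ hxyz h₁ h₂)
    fun i τ => ?_
  · have h := continuous_betaFn_linePt (re_shift_pos h₁ i.1 i.2.2) (re_shift_pos h₂ i.1 i.2.1)
    have e (b : ℂ) (τ : ℝ) (m n : ℕ) : b + linePt c τ + m + n = b + m + n + linePt c τ := by ring
    simp only [termHBa, e]
    exact continuous_const.mul (h.div_const _)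
  · have := norm_termHBa_le b₁ b₂ b₃ (c₁ := c₁) (c₂ := c₂) (c₃ := c₃) (x := x) (y := y) (z := z)
      (s := linePt c τ) (by rwa [linePt_re]) (by rwa [linePt_re]) i
    rwa [linePt_re] at this

theorem norm_HBa_linePt_le (hc₁ : NotNonposInt c₁) (hc₂ : NotNonposInt c₂)
    (hc₃ : NotNonposInt c₃) (hxyz : InRegion x y z) {c : ℝ} (h₁ : 0 < b₁.re + c)
    (h₂ : 0 < b₂.re + c) (τ : ℝ) :
    ‖HBa (linePt c τ) b₁ b₂ b₃ c₁ c₂ c₃ x y z‖ ≤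
      ∑' i, majorant b₁ b₂ b₃ c₁ c₂ c₃ x y z c i := by
  refine tsum_of_norm_bounded (summable_majorant b₁ b₂ b₃ hc₁ hc₂ hc₃ hxyz h₁ h₂).hasSum
    fun i => ?_
  have := norm_termHBa_le b₁ b₂ b₃ (c₁ := c₁) (c₂ := c₂) (c₃ := c₃) (x := x) (y := y) (z := z)
    (s := linePt c τ) (by rwa [linePt_re]) (by rwa [linePt_re]) i
  rwa [linePt_re] at this

theorem integrable_mellinFactor_mul_HBa (hc₁ : NotNonposInt c₁) (hc₂ : NotNonposInt c₂)
    (hc₃ : NotNonposInt c₃) (hxyz : InRegion x y z) {ν c : ℝ} (hν : 0 ≤ ν) (hc : ν < c)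
    (h₁ : 0 < b₁.re + c) (h₂ : 0 < b₂.re + c) {p : ℂ} (hp : 0 < p.re) :
    Integrable fun τ : ℝ =>
      mellinFactor p ν (linePt c τ) * HBa (linePt c τ) b₁ b₂ b₃ c₁ c₂ c₃ x y z := by
  have hp0 : p ≠ 0 := by rintro rfl; simp at hp
  obtain ⟨δ, K, hδ, hK, h⟩ := exists_norm_mellinFactor_le hp hν hc
  refine (((integrable_exp_neg_mul_abs hδ).const_mul K).mul_const
    (∑' i, majorant b₁ b₂ b₃ c₁ c₂ c₃ x y z c i)).mono'
    ((continuous_mellinFactor_linePt hp0 hν hc).mul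
      (continuous_HBa_linePt b₁ b₂ b₃ hc₁ hc₂ hc₃ hxyz h₁ h₂)).aestronglyMeasurable
    (.of_forall fun τ => ?_)
  rw [norm_mul]
  gcongr
  · exact h τ
  · exact norm_HBa_linePt_le b₁ b₂ b₃ hc₁ hc₂ hc₃ hxyz h₁ h₂ τ

theorem hasMellin_termHB {ν : ℝ} (hν : 0 ≤ ν) {p s : ℂ} (hp : 0 < p.re) (hs : ν < s.re)
    (h₁ : 0 < b₁.re + s.re) (h₂ : 0 < b₂.re + s.re) (i : ℕ × ℕ × ℕ) :
    HasMellin (fun q : ℝ => termHB (p * q) ν b₁ b₂ b₃ c₁ c₂ c₃ x y z i) s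
      (mellinFactor p ν s * termHBa s b₁ b₂ b₃ c₁ c₂ c₃ x y z i) := by
  have h := hasMellin_const_smul (hasMellin_extBeta hp hν hs (re_shift_pos h₁ i.1 i.2.2)
    (re_shift_pos h₂ i.1 i.2.1)).1
    (coeff b₁ b₂ b₃ c₁ c₂ c₃ x y z i.1 i.2.1 i.2.2 / betaFn b₁ b₂)
  rw [(hasMellin_extBeta hp hν hs (re_shift_pos h₁ i.1 i.2.2) (re_shift_pos h₂ i.1 i.2.1)).2] at h
  convert h using 1
  · funext q
    rw [termHB, smul_eq_mul]
    ring
  · rw [termHBa, smul_eq_mul, show b₁ + s + i.1 + i.2.2 = b₁ + i.1 + i.2.2 + s by ring,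
      show b₂ + s + i.1 + i.2.1 = b₂ + i.1 + i.2.1 + s by ring]
    ring

/-- The Mellin transform of `q ↦ H_{B,pq,ν}`. -/
theorem hasMellin_HB (hc₁ : NotNonposInt c₁) (hc₂ : NotNonposInt c₂) (hc₃ : NotNonposInt c₃)
    (hxyz : InRegion x y z) {ν : ℝ} (hν : 0 ≤ ν) {p s : ℂ} (hp : 0 < p.re) (hs : ν < s.re)
    (h₁ : 0 < b₁.re + s.re) (h₂ : 0 < b₂.re + s.re) :
    HasMellin (fun q : ℝ => HB (p * q) ν b₁ b₂ b₃ c₁ c₂ c₃ x y z) s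
      (mellinFactor p ν s * HBa s b₁ b₂ b₃ c₁ c₂ c₃ x y z) := by
  set F : ℕ × ℕ × ℕ → ℝ → ℂ := fun i q =>
    (q : ℂ) ^ (s - 1) • termHB (p * q) ν b₁ b₂ b₃ c₁ c₂ c₃ x y z i with hF
  have hm (i) := hasMellin_termHB b₁ b₂ b₃ (c₁ := c₁) (c₂ := c₂) (c₃ := c₃) (x := x) (y := y)
    (z := z) hν hp hs h₁ h₂ i
  have hint (i) : Integrable (F i) (volume.restrict (Set.Ioi 0)) := (hm i).1
  have hre {q : ℝ} (hq : 0 < q) : 0 < (p * q).re := by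
    rw [Complex.re_mul_ofReal]; exact mul_pos hp hq
  obtain ⟨A, hA⟩ := exists_integral_norm_extBeta_le s hp hν hs
  have hsum : Summable fun i => ∫ q in Set.Ioi (0 : ℝ), ‖F i q‖ := by
    refine .of_nonneg_of_le (fun i => by positivity) (fun i => ?_)
      ((summable_majorant b₁ b₂ b₃ hc₁ hc₂ hc₃ hxyz h₁ h₂).mul_left A)
    have e (q : ℝ) : ‖F i q‖ = ‖coeff b₁ b₂ b₃ c₁ c₂ c₃ x y z i.1 i.2.1 i.2.2‖ /
        ‖betaFn b₁ b₂‖ * ‖(q : ℂ) ^ (s - 1) •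
          extBeta (p * q) ν (b₁ + i.1 + i.2.2) (b₂ + i.1 + i.2.1)‖ := by
      simp only [hF, termHB, norm_smul, norm_mul, norm_div]
      ring
    simp only [e]
    rw [integral_const_mul, majorant]
    refine (mul_le_mul_of_nonneg_left (hA _ _ (re_shift_pos h₁ _ _) (re_shift_pos h₂ _ _))
      (by positivity)).trans_eq ?_
    ring
  have hpt (q : ℝ) : ∑' i, F i q = (q : ℂ) ^ (s - 1) • HB (p * q) ν b₁ b₂ b₃ c₁ c₂ c₃ x y z := by
    simp only [hF, smul_eq_mul]
    rw [tsum_mul_left, HB]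
  have hcont : ContinuousOn (fun q : ℝ =>
      (q : ℂ) ^ (s - 1) • HB (p * q) ν b₁ b₂ b₃ c₁ c₂ c₃ x y z) (Set.Ioi 0) := by
    refine (continuousOn_ofReal_cpow _).smul fun q hq => ContinuousAt.continuousWithinAt ?_
    exact ContinuousAt.comp (f := fun q : ℝ => p * q)
      (continuousAt_HB b₁ b₂ b₃ hc₁ hc₂ hc₃ hxyz hν hs h₁ h₂ (hre hq)) (by fun_prop)
  constructor
  · refine (integrable_tsum_of_summable_integral_norm hint hsum ?_ ?_).congr (.of_forall hpt)
    · refine (ae_restrict_iff' measurableSet_Ioi).2 (.of_forall fun q hq => ?_)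
      exact (summable_termHB b₁ b₂ b₃ hc₁ hc₂ hc₃ hxyz hν hs h₁ h₂ (hre hq)).const_smul _
    -- Measurability of the sum comes from its continuity on q > 0.
    · exact (hcont.aestronglyMeasurable measurableSet_Ioi).congr (.of_forall fun q => (hpt q).symm)
  · have h := (hasSum_integral_of_summable_integral_norm hint hsum).tsum_eq
    simp only [hpt] at h
    rw [mellin, ← h, HBa, ← tsum_mul_left]
    exact tsum_congr fun i => (hm i).2

end Series

end ExtendedSrivastava

/-! ### Mellin inversion -/

theorem corollary1 (p : ℂ) (hp : 0 < p.re) (ν : ℝ) (hν : 0 ≤ ν)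
    (b₁ b₂ b₃ c₁ c₂ c₃ x y z : ℂ)
    (hb₁ : ExtendedSrivastava.NotNonposInt b₁) (hb₂ : ExtendedSrivastava.NotNonposInt b₂)
    (hb₁₂ : ExtendedSrivastava.NotNonposInt (b₁ + b₂))
    (hc₁ : ExtendedSrivastava.NotNonposInt c₁) (hc₂ : ExtendedSrivastava.NotNonposInt c₂)
    (hc₃ : ExtendedSrivastava.NotNonposInt c₃)
    (hxyz : ExtendedSrivastava.InRegion x y z)
    (c : ℝ) (hc : ν < c) (hcb₁ : -b₁.re < c) (hcb₂ : -b₂.re < c) :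
    -- the series of `H_{B,p,ν}`, and those of `H_B^{(s)}` for `Re s = c`, converge
    Summable (ExtendedSrivastava.termHB p ν b₁ b₂ b₃ c₁ c₂ c₃ x y z) ∧
    (∀ s : ℂ, s.re = c →
      Summable (ExtendedSrivastava.termHBa s b₁ b₂ b₃ c₁ c₂ c₃ x y z)) ∧
    -- the Mellin transform of `q ↦ H_{B,q,ν}`, `q > 0`, exists on the line `Re s = c`
    (∀ s : ℂ, s.re = c →
      MellinConvergent
        (fun q : ℝ => ExtendedSrivastava.HB (q : ℂ) ν b₁ b₂ b₃ c₁ c₂ c₃ x y z) s) ∧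
    -- `H_{B,p,ν}` is the inverse Mellin transform of it
    ExtendedSrivastava.LineIntegrable c (fun s : ℂ => p ^ (-s) *
      mellin (fun q : ℝ => ExtendedSrivastava.HB (q : ℂ) ν b₁ b₂ b₃ c₁ c₂ c₃ x y z) s) ∧
    ExtendedSrivastava.HB p ν b₁ b₂ b₃ c₁ c₂ c₃ x y z =
      1 / (2 * (Real.pi : ℂ) * Complex.I) *
        ExtendedSrivastava.lineIntegral c (fun s : ℂ => p ^ (-s) *
          mellin (fun q : ℝ => ExtendedSrivastava.HB (q : ℂ) ν b₁ b₂ b₃ c₁ c₂ c₃ x y z) s) ∧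
    -- the explicit form of the inversion integral
    ExtendedSrivastava.LineIntegrable c (fun s : ℂ => (2 / p) ^ s *
      Complex.Gamma ((s - ν) / 2) * Complex.Gamma ((s + ν + 1) / 2) *
        ExtendedSrivastava.HBa s b₁ b₂ b₃ c₁ c₂ c₃ x y z) ∧
    ExtendedSrivastava.HB p ν b₁ b₂ b₃ c₁ c₂ c₃ x y z =
      (Real.pi : ℂ) ^ (-(3 / 2) : ℂ) / (4 * Complex.I) *
        ExtendedSrivastava.lineIntegral c (fun s : ℂ => (2 / p) ^ s *
          Complex.Gamma ((s - ν) / 2) * Complex.Gamma ((s + ν + 1) / 2) *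
            ExtendedSrivastava.HBa s b₁ b₂ b₃ c₁ c₂ c₃ x y z) := by
  have h₁ : 0 < b₁.re + c := by linarith
  have h₂ : 0 < b₂.re + c := by linarith
  have hpi : (Real.pi : ℂ) ≠ 0 := by exact_mod_cast Real.pi_pos.ne'
  have hmel (q : ℂ) (hq : 0 < q.re) (s : ℂ) (hs : s.re = c) := ExtendedSrivastava.hasMellin_HB
    b₁ b₂ b₃ hc₁ hc₂ hc₃ hxyz hν hq (hs ▸ hc) (hs ▸ h₁) (hs ▸ h₂)
  have hmel1 (s : ℂ) (hs : s.re = c) := hmel 1 (by simp) s hs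
  simp only [one_mul] at hmel1
  have hG := ExtendedSrivastava.integrable_mellinFactor_mul_HBa b₁ b₂ b₃ hc₁ hc₂ hc₃ hxyz hν hc
    h₁ h₂ hp
  have hinv : ExtendedSrivastava.HB p ν b₁ b₂ b₃ c₁ c₂ c₃ x y z = (1 / (2 * Real.pi) : ℂ) *
      ∫ τ : ℝ, ExtendedSrivastava.mellinFactor p ν (ExtendedSrivastava.linePt c τ) *
        ExtendedSrivastava.HBa (ExtendedSrivastava.linePt c τ) b₁ b₂ b₃ c₁ c₂ c₃ x y z := by
    have hval (τ : ℝ) := (hmel p hp (ExtendedSrivastava.linePt c τ)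
      (ExtendedSrivastava.linePt_re c τ)).2
    -- Inversion is applied to q ↦ H_{B,pq,ν} at q = 1, where the inverse kernel q^{-s} is 1. It
    -- needs convergence of the transform at c, its integrability along the line, and continuity at
    -- q = 1.
    have h := mellinInv_mellin_eq c
      (fun q : ℝ => ExtendedSrivastava.HB (p * q) ν b₁ b₂ b₃ c₁ c₂ c₃ x y z) one_pos
      (hmel p hp c (Complex.ofReal_re c)).1 (hG.congr (.of_forall fun τ => (hval τ).symm))
      (ContinuousAt.comp (f := fun q : ℝ => p * q) (ExtendedSrivastava.continuousAt_HB
        b₁ b₂ b₃ hc₁ hc₂ hc₃ hxyz hν hc h₁ h₂ (by simpa using hp)) (by fun_prop))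
    rw [Complex.ofReal_one, mul_one] at h
    rw [← h, mellinInv, Complex.real_smul]
    push_cast
    congr 1
    refine integral_congr_ae (.of_forall fun τ => ?_)
    simp only [Complex.one_cpow, one_smul]
    exact hval τ
  -- The parameter p enters `mellinFactor` only through p^{-s}, so p^{-s} Φ(s) is the integrand just
  -- inverted.
  have hline (τ : ℝ) : p ^ (-ExtendedSrivastava.linePt c τ) *
      mellin (fun q : ℝ => ExtendedSrivastava.HB (q : ℂ) ν b₁ b₂ b₃ c₁ c₂ c₃ x y z)
        (ExtendedSrivastava.linePt c τ) =
      ExtendedSrivastava.mellinFactor p ν (ExtendedSrivastava.linePt c τ) *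
        ExtendedSrivastava.HBa (ExtendedSrivastava.linePt c τ) b₁ b₂ b₃ c₁ c₂ c₃ x y z := by
    rw [(hmel1 _ (ExtendedSrivastava.linePt_re c τ)).2,
      ExtendedSrivastava.mellinFactor_eq_cpow_mul_one p, mul_assoc]
  refine ⟨ExtendedSrivastava.summable_termHB b₁ b₂ b₃ hc₁ hc₂ hc₃ hxyz hν hc h₁ h₂ hp,
    fun s hs => ExtendedSrivastava.summable_termHBa b₁ b₂ b₃ hc₁ hc₂ hc₃ hxyz (hs ▸ h₁) (hs ▸ h₂),
    fun s hs => (hmel1 s hs).1, ?_, ?_, ?_, ?_⟩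
  · simp only [ExtendedSrivastava.LineIntegrable, hline]
    exact hG
  · simp only [ExtendedSrivastava.lineIntegral, hline]
    rw [hinv, integral_mul_const]
    have := Complex.I_ne_zero
    field_simp
  · simp only [ExtendedSrivastava.LineIntegrable, ExtendedSrivastava.two_div_cpow_mul_Gamma hp,
      mul_assoc _ (ExtendedSrivastava.mellinFactor _ _ _)]
    exact hG.const_mul _
  · simp only [ExtendedSrivastava.lineIntegral, ExtendedSrivastava.two_div_cpow_mul_Gamma hp,
      mul_assoc _ (ExtendedSrivastava.mellinFactor _ _ _)]
    rw [hinv, integral_mul_const, integral_const_mul]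
    -- With ds = i dτ, the constants combine as π^{-3/2}/(4i) · 2π^{1/2} · i = 1/(2π), the
    -- normalisation of Mellin inversion.
    have e : (Real.pi : ℂ) ^ (-(3 / 2) : ℂ) * (Real.pi : ℂ) ^ (1 / 2 : ℂ) = (Real.pi : ℂ)⁻¹ := by
      rw [← Complex.cpow_add _ _ hpi, show (-(3 / 2) : ℂ) + 1 / 2 = -1 by norm_num,
        Complex.cpow_neg_one]
    have hI := Complex.I_ne_zero
    have e2 (X : ℂ) : (Real.pi : ℂ) ^ (-(3 / 2) : ℂ) / (4 * Complex.I) *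
        (2 * (Real.pi : ℂ) ^ (1 / 2 : ℂ) * X * Complex.I) =
        ((Real.pi : ℂ) ^ (-(3 / 2) : ℂ) * (Real.pi : ℂ) ^ (1 / 2 : ℂ)) / 2 * X := by
      field_simp
      ring
    rw [e2, e]
    field_simp
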